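/- Let $\mathcal C$ be a (not necessarily strict, rigid or semisimple) $C^*$-tensor category, with unitary associators $a_{X,Y,Z}:X\otimes(Y\otimes Z)\to(X\otimes Y)\otimes Z$ and unitary unitors, and with simple tensor unit $\mathbf 1$, i.e. $\operatorname{Hom}(\mathbf 1,\mathbf 1)\cong\mathbb C$. An algebra $A=(X,m,\iota)$ in $\mathcal C$ is an object $X$ with an associative multiplication $m:X\otimes X\to X$ and a monic two-sided unit $\iota:\mathbf 1\to X$. It is *haploid* if $\dim\operatorname{Hom}(\mathbf 1,X)=1$, and *normalized* if $\iota^*\iota=1_{\mathbf 1}$. A haploid algebra is *rigid* if, for the unique $\varepsilon:X\to\mathbf 1$ with $\varepsilon\iota=1_{\mathbf 1}$, the morphism $\varepsilon m:X\otimes X\to\mathbf 1$ is the evaluation of a solution of the conjugate (duality) equations for $X$ and $\overline X=X$. A *Q-system* is an algebra which is special ($mm^*$ is a scalar multiple of $1_X$) and $C^*$-Frobenius, i.e. $(m\otimes 1_X)\,a_{X,X,X}\,(1_X\otimes m^*)=m^*m=(1_X\otimes m)\,a_{X,X,X}^{-1}\,(m^*\otimes 1_X)$. It is *standard* if $e=\iota^*m$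 and $i=m^*\iota$ form a standard solution of the conjugate equations for $X$ and $\overline X=X$, i.e. a solution with $e(1_{\overline X}\otimes T)e^*=i^*(T\otimes 1_{\overline X})i$ for all $T\in\operatorname{Hom}(X,X)$. An *equivalence* from $(X,m,\iota)$ to $(Y,n,j)$ is an isomorphism $S:X\to Y$ with $Sm=n(S\otimes S)$ and $S\iota=j$; it is a *unitary equivalence* if moreover $S$ is unitary. Theorem. (a) Every normalized haploid Q-system in $\mathcal C$ is standard. (b) Every equivalence of algebras between two normalized haploid Q-systems in $\mathcal C$ is unitary. (c) Every normalized haploid Q-system is a rigid haploid algebra, and sending a normalized haploid Q-system to its underlying algebra induces a one-to-one correspondence between unitary equivalence classes of normalized haploid Q-systems in $\mathcal C$ and equivalence classes of rigid haploid algebras in $\mathcal C$. -/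

import Mathlib

/-!
Let `A` be a rigid haploid algebra. Rigidity makes `End X` a finite-dimensional C*-algebra, on which
`T ↦ m (1 ⊗ T) m*` is a positive map. Haploidness makes it irreducible, so by Perron–Frobenius it
has an invertible positive eigenvector, and conjugating `m` by the square root of that eigenvector
gives an action `n` of `A` on `X` with `n n*` scalar. Bending the last leg of `n` represents `A` as
a submodule of the free module `X ⊗ X̄`. The complement of a submodule is again a submodule: its
defect is positive and has zero partial trace, as the Perron–Frobenius eigenvalue admits no strictly
superharmonic element. Once the embedding of `A` is made isometric, the Frobenius relation therefore
descends from `X ⊗ X̄` to `A`.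

Conversely, for a haploid C*-Frobenius algebra, `m (1 ⊗ T) m*` and `m (T ⊗ 1) m*` are module
endomorphisms of `A`, hence scalars, and associativity forces the two scalars to agree: this is
standardness. For an equivalence `S`, the same argument shows that `S` and `(S⁻¹)*` are
proportional, and comparison of the units makes `S` unitary.
-/

open CategoryTheory MonoidalCategory
open scoped MonObj ComplexConjugate

universe v u

/-- A C*-category: a `ℂ`-linear category whose morphism spaces are complex Banach spaces with a
submultiplicative norm, equipped with an antilinear involutive contravariant `*`-operation that is
the identity on objects, satisfying the C*-identity, and such that every `S* S` is positive in the
C*-algebra of endomorphisms of the source of `S`.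

Composition is written in diagrammatic order, so `S* S` is `S ≫ dag S`. -/
class CStarCategory (C : Type u) [Category.{v} C] [Preadditive C] [Linear ℂ C] where
  /-- The norm of a morphism. -/
  homNorm (X Y : C) : Norm (X ⟶ Y)
  homNorm_core (X Y : C) : NormedSpace.Core ℂ (X ⟶ Y)
  complete (X Y : C) :
    @CompleteSpace (X ⟶ Y) (NormedAddCommGroup.ofCore (homNorm_core X Y)).toUniformSpace
  norm_comp_le {X Y Z : C} (f : X ⟶ Y) (g : Y ⟶ Z) :
    (homNorm X Z).norm (f ≫ g) ≤ (homNorm X Y).norm f * (homNorm Y Z).norm g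
  /-- The adjoint `S*` of a morphism `S`. -/
  dag {X Y : C} (f : X ⟶ Y) : Y ⟶ X
  dag_dag {X Y : C} (f : X ⟶ Y) : dag (dag f) = f
  dag_id (X : C) : dag (𝟙 X) = 𝟙 X
  dag_comp {X Y Z : C} (f : X ⟶ Y) (g : Y ⟶ Z) : dag (f ≫ g) = dag g ≫ dag f
  dag_add {X Y : C} (f g : X ⟶ Y) : dag (f + g) = dag f + dag g
  dag_smul {X Y : C} (c : ℂ) (f : X ⟶ Y) : dag (c • f) = conj c • dag f
  norm_comp_dag {X Y : C} (f : X ⟶ Y) :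
    (homNorm X X).norm (f ≫ dag f) = (homNorm X Y).norm f ^ 2
  comp_dag_positive {X Y : C} (f : X ⟶ Y) : ∃ t : X ⟶ X, f ≫ dag f = t ≫ dag t

attribute [reducible, instance] CStarCategory.homNorm

/-- A (not necessarily strict) C*-tensor category: a C*-category with a bilinear monoidal structure
for which `(S ⊗ T)* = S* ⊗ T*` and the associators and unitors are unitary. -/
class CStarTensorCategory (C : Type u) [Category.{v} C] [Preadditive C] [Linear ℂ C]
    [MonoidalCategory C] [MonoidalPreadditive C] [MonoidalLinear ℂ C]
    extends CStarCategory C where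
  dag_tensorHom {X₁ Y₁ X₂ Y₂ : C} (f : X₁ ⟶ Y₁) (g : X₂ ⟶ Y₂) :
    dag (f ⊗ₘ g) = dag f ⊗ₘ dag g
  dag_associator_hom (X Y Z : C) : dag (α_ X Y Z).hom = (α_ X Y Z).inv
  dag_leftUnitor_hom (X : C) : dag (λ_ X).hom = (λ_ X).inv
  dag_rightUnitor_hom (X : C) : dag (ρ_ X).hom = (ρ_ X).inv

namespace CStarTensorCategory

open CStarCategory (dag dag_id dag_comp dag_dag)

section Equivalence

variable {C : Type u} [Category.{v} C] [MonoidalCategory C]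

/-- An equivalence between two algebras: an isomorphism intertwining multiplications and units. -/
def IsEquivalence (A B : Mon C) (S : A.X ≅ B.X) : Prop :=
  μ[A.X] ≫ S.hom = (S.hom ⊗ₘ S.hom) ≫ μ[B.X] ∧ η[A.X] ≫ S.hom = η[B.X]

/-- Two algebras are equivalent. -/
def Equivalent (A B : Mon C) : Prop := ∃ S : A.X ≅ B.X, IsEquivalence A B S

theorem Equivalent.refl (A : Mon C) : Equivalent A A :=
  ⟨Iso.refl _, by simp [IsEquivalence]⟩

theorem IsEquivalence.symm {A B : Mon C} {S : A.X ≅ B.X} (h : IsEquivalence A B S) :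
    IsEquivalence B A S.symm := by
  constructor
  · simp only [Iso.symm_hom, Iso.comp_inv_eq, Category.assoc, h.1]
    simp
  · simp [Iso.comp_inv_eq, h.2]

theorem IsEquivalence.trans {A B D : Mon C} {S : A.X ≅ B.X} {T : B.X ≅ D.X}
    (h : IsEquivalence A B S) (k : IsEquivalence B D T) : IsEquivalence A D (S ≪≫ T) := by
  constructor
  · simp only [Iso.trans_hom, ← Category.assoc, h.1]
    simp only [Category.assoc, k.1]
    simp
  · simp only [Iso.trans_hom, ← Category.assoc, h.2, k.2]

end Equivalence

variable {C : Type u} [Category.{v} C] [Preadditive C] [Linear ℂ C]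

/-- A morphism `S` is unitary if `S* S = 1` and `S S* = 1`. -/
def IsUnitary [CStarCategory C] {X Y : C} (S : X ⟶ Y) : Prop :=
  S ≫ dag S = 𝟙 X ∧ dag S ≫ S = 𝟙 Y

theorem IsUnitary.id [CStarCategory C] (X : C) : IsUnitary (𝟙 X) := by
  simp [IsUnitary, dag_id]

theorem IsUnitary.symm [CStarCategory C] {X Y : C} {S : X ≅ Y} (h : IsUnitary S.hom) :
    IsUnitary S.symm.hom := by
  have e : S.inv = dag S.hom := by rw [← Category.comp_id S.inv, Iso.inv_comp_eq, h.1]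
  constructor
  · simp only [Iso.symm_hom, e, dag_dag, h.2]
  · simp only [Iso.symm_hom, e, dag_dag, h.1]

theorem IsUnitary.comp [CStarCategory C] {X Y Z : C} {S : X ⟶ Y} {T : Y ⟶ Z}
    (h : IsUnitary S) (k : IsUnitary T) : IsUnitary (S ≫ T) := by
  constructor
  · rw [dag_comp, Category.assoc, ← Category.assoc T, k.1, Category.id_comp, h.1]
  · rw [dag_comp, Category.assoc, ← Category.assoc (dag S), h.2, Category.id_comp, k.2]

variable [MonoidalCategory C] [MonoidalPreadditive C] [MonoidalLinear ℂ C]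

variable (C) in
/-- The tensor unit is simple: its endomorphism space is one-dimensional. -/
def SimpleUnit : Prop := Module.finrank ℂ (𝟙_ C ⟶ 𝟙_ C) = 1

/-- An algebra `A = (X, m, ι)`, i.e. a monoid object with monic unit, is haploid if
`Hom(1, X)` is one-dimensional. -/
def IsHaploid (A : Mon C) : Prop := Module.finrank ℂ (𝟙_ C ⟶ A.X) = 1

/-- Rigidity of a haploid algebra: with `ε : X ⟶ 1` the (unique) morphism such that `ε ι = 1`,
the morphism `ε m : X ⊗ X ⟶ 1` is the evaluation of a solution of the conjugate equations
for `X` and `X`. -/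
def IsRigid (A : Mon C) : Prop :=
  ∃ ε : A.X ⟶ 𝟙_ C, η[A.X] ≫ ε = 𝟙 (𝟙_ C) ∧
    ∃ p : ExactPairing A.X A.X, p.evaluation' = μ[A.X] ≫ ε

section CStar

variable [CStarTensorCategory C]

/-- Two algebras are unitarily equivalent. -/
def UnitarilyEquivalent (A B : Mon C) : Prop :=
  ∃ S : A.X ≅ B.X, IsEquivalence A B S ∧ IsUnitary S.hom

/-- The unit of the algebra is an isometry. -/
def IsNormalized (A : Mon C) : Prop := η[A.X] ≫ dag η[A.X] = 𝟙 (𝟙_ C)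

/-- `m m*` is a scalar multiple of the identity. -/
def IsSpecial (A : Mon C) : Prop := ∃ c : ℂ, dag μ[A.X] ≫ μ[A.X] = c • 𝟙 A.X

/-- The Frobenius relations
`(m ⊗ 1) a (1 ⊗ m*) = m* m = (1 ⊗ m) a⁻¹ (m* ⊗ 1)`, where `a : X ⊗ (X ⊗ X) ⟶ (X ⊗ X) ⊗ X`. -/
def IsCStarFrobenius (A : Mon C) : Prop :=
  A.X ◁ dag μ[A.X] ≫ (α_ A.X A.X A.X).inv ≫ μ[A.X] ▷ A.X = μ[A.X] ≫ dag μ[A.X] ∧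
  μ[A.X] ≫ dag μ[A.X] = dag μ[A.X] ▷ A.X ≫ (α_ A.X A.X A.X).hom ≫ A.X ◁ μ[A.X]

/-- A Q-system: an algebra that is special and C*-Frobenius. -/
structure IsQSystem (A : Mon C) : Prop where
  mono_unit : Mono η[A.X]
  special : IsSpecial A
  frobenius : IsCStarFrobenius A

/-- A solution `e : X̄ ⊗ X ⟶ 1`, `i : 1 ⟶ X ⊗ X̄` of the conjugate equations is standard if it is
spherical: `e (1 ⊗ T) e* = i* (T ⊗ 1) i` for every endomorphism `T` of `X`. For `T = 1` this is
the normalization `e e* = i* i = d(X) 1`. (This makes sense without assuming direct sums or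
subobjects in `C`.) -/
def IsStandardSolution {X Xbar : C} (p : ExactPairing X Xbar) : Prop :=
  ∀ T : X ⟶ X,
    dag p.evaluation' ≫ (Xbar ◁ T) ≫ p.evaluation' =
      p.coevaluation' ≫ (T ▷ Xbar) ≫ dag p.coevaluation'

/-- An algebra is standard if `e_A = ι* m` and `i_A = m* ι` form a standard solution of the
conjugate equations for `X` and `X`. -/
def IsStandard (A : Mon C) : Prop :=
  ∃ p : ExactPairing A.X A.X,
    p.evaluation' = μ[A.X] ≫ dag η[A.X] ∧ p.coevaluation' = η[A.X] ≫ dag μ[A.X] ∧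
      IsStandardSolution p

end CStar

variable (C) in
/-- Rigid haploid algebras in `C`. -/
structure RigidHaploidAlgebra where
  /-- The underlying monoid object. -/
  alg : Mon C
  mono_unit : Mono η[alg.X]
  haploid : IsHaploid alg
  rigid : IsRigid alg

variable (C) in
/-- Normalized haploid Q-systems in `C`. -/
structure NormalizedHaploidQSystem [CStarTensorCategory C] where
  /-- The underlying monoid object. -/
  alg : Mon C
  isQSystem : IsQSystem alg
  haploid : IsHaploid alg
  normalized : IsNormalized alg

variable (C) in
/-- Equivalence of rigid haploid algebras. -/
def RigidHaploidAlgebra.setoid : Setoid (RigidHaploidAlgebra C) where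
  r A B := Equivalent A.alg B.alg
  iseqv :=
    { refl := fun A => Equivalent.refl A.alg
      symm := fun ⟨S, h⟩ => ⟨S.symm, h.symm⟩
      trans := fun ⟨S, h⟩ ⟨T, k⟩ => ⟨S ≪≫ T, h.trans k⟩ }

variable (C) in
/-- Unitary equivalence of normalized haploid Q-systems. -/
def NormalizedHaploidQSystem.setoid [CStarTensorCategory C] :
    Setoid (NormalizedHaploidQSystem C) where
  r A B := UnitarilyEquivalent A.alg B.alg
  iseqv :=
    { refl := fun A => ⟨Iso.refl _, by simp [IsEquivalence], IsUnitary.id _⟩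
      symm := fun ⟨S, h, h'⟩ => ⟨S.symm, h.symm, h'.symm⟩
      trans := fun ⟨S, h, h'⟩ ⟨T, k, k'⟩ => ⟨S ≪≫ T, h.trans k, h'.comp k'⟩ }

variable (C) in
/-- Equivalence classes of rigid haploid algebras. -/
abbrev RigidHaploidAlgebraClass := Quotient (RigidHaploidAlgebra.setoid C)

variable (C) in
/-- Unitary equivalence classes of normalized haploid Q-systems. -/
abbrev NormalizedHaploidQSystemClass [CStarTensorCategory C] :=
  Quotient (NormalizedHaploidQSystem.setoid C)

end CStarTensorCategory

namespace CStarTensorCategory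

open CStarCategory (dag dag_id dag_comp dag_dag dag_add dag_smul norm_comp_le norm_comp_dag)

/-! ### Positive maps on finite-dimensional C*-algebras -/

section PerronFrobenius

section Definitions

variable {R E : Type*} [SMul R E] [Zero E] [LE E]

/-- A positive element `p` is superharmonic for `Φ` at level `l` if `Φ p ≤ l p`, as in potential
theory. -/
def IsSuperharmonic (Φ : E → E) (l : R) (p : E) : Prop :=
  0 ≤ p ∧ Φ p ≤ l • p

/-- The map `Φ` is recurrent at level `l` if every superharmonic element at level `l` is harmonic.
The term is borrowed from Markov chains, where this characterizes recurrence. -/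
def IsRecurrent (Φ : E → E) (l : R) : Prop :=
  ∀ p, IsSuperharmonic Φ l p → Φ p = l • p

end Definitions

variable {A : Type*} [CStarAlgebra A] [PartialOrder A]

/-- A map on a C*-algebra is irreducible, in the sense of Perron and Frobenius, if its nonzero
superharmonic elements are invertible. -/
def IsIrreducibleMap (Φ : A → A) : Prop :=
  ∀ (l : ℝ) (p : A), IsSuperharmonic Φ l p → p ≠ 0 → IsUnit p

variable [StarOrderedRing A]

theorem exists_pos_smul_le_of_isUnit {a b : A} (ha : 0 ≤ a) (hu : IsUnit a) (hb : 0 ≤ b) :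
    ∃ r : ℝ, 0 < r ∧ r • b ≤ a := by
  rcases subsingleton_or_nontrivial A with _ | _
  · exact ⟨1, one_pos, (Subsingleton.elim _ _).le⟩
  have hs : IsStrictlyPositive a := ⟨ha, hu⟩
  obtain ⟨r, hr, hra⟩ := (CFC.exists_pos_algebraMap_le_iff hs.isSelfAdjoint).2
    fun x hx ↦ hs.spectrum_pos hx
  have hb_le : b ≤ algebraMap ℝ A ‖b‖ := (IsSelfAdjoint.of_nonneg hb).le_algebraMap_norm_self
  refine ⟨r / (‖b‖ + 1), by positivity, ?_⟩
  calc (r / (‖b‖ + 1)) • b ≤ (r / (‖b‖ + 1)) • algebraMap ℝ A ‖b‖ := by gcongr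
    _ = algebraMap ℝ A (r / (‖b‖ + 1) * ‖b‖) := by
        rw [map_mul, ← Algebra.smul_def]
    _ ≤ algebraMap ℝ A r := by
        refine algebraMap_mono A ?_
        rw [div_mul_eq_mul_div, div_le_iff₀ (by positivity)]
        nlinarith [norm_nonneg b]
    _ ≤ a := hra

theorem tsum_pow_apply_nonneg {S : A →L[ℂ] A} (hS : ‖S‖ < 1) (hpos : ∀ a, 0 ≤ a → 0 ≤ S a)
    {a : A} (ha : 0 ≤ a) : 0 ≤ (∑' i : ℕ, S ^ i) a := by
  have hpow : ∀ i : ℕ, 0 ≤ (S ^ i) a := by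
    intro i
    induction i with
    | zero => exact ha
    | succ i ih => exact pow_succ' S i ▸ hpos _ ih
  have hsum : HasSum (fun i : ℕ ↦ (S ^ i) a) ((∑' i : ℕ, S ^ i) a) :=
    (summable_geometric_of_norm_lt_one hS).hasSum.mapL (ContinuousLinearMap.apply ℂ A a)
  exact CStarAlgebra.isClosed_nonneg.mem_of_tendsto hsum
    (.of_forall fun s ↦ Finset.sum_nonneg fun i _ ↦ hpow i)

variable {Φ : A →ₗ[ℂ] A}

theorem exists_positive_resolvent [FiniteDimensional ℂ A] (hpos : ∀ a, 0 ≤ a → 0 ≤ Φ a) :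
    ∃ (R : A →ₗ[ℂ] A) (r : ℝ), 0 < r ∧ (∀ a, 0 ≤ a → 0 ≤ R a) ∧
      (∀ a, R a - r • Φ (R a) = a) ∧ ∀ a, R (Φ a) = Φ (R a) := by
  let T : A →L[ℂ] A := LinearMap.toContinuousLinearMap Φ
  let r : ℝ := (‖T‖ + 1)⁻¹
  have hr : 0 < r := by positivity
  let S : A →L[ℂ] A := (r : ℂ) • T
  have hS : ‖S‖ < 1 := by
    rw [norm_smul, Complex.norm_real, Real.norm_of_nonneg hr.le, inv_mul_lt_iff₀ (by positivity)]
    linarith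
  have hSa : ∀ a, S a = r • Φ a := fun a ↦ Complex.coe_smul r (Φ a)
  have hST : Commute S T := ContinuousLinearMap.ext fun a ↦ (map_smul T (r : ℂ) (T a)).symm
  have hcomm : Commute (∑' i : ℕ, S ^ i) T := Commute.tsum_left _ fun i ↦ hST.pow_left i
  refine ⟨(∑' i : ℕ, S ^ i : A →L[ℂ] A), r, hr, fun a ha ↦ ?_, fun a ↦ ?_, fun a ↦ ?_⟩
  · exact tsum_pow_apply_nonneg hS (fun b hb ↦ hSa b ▸ smul_nonneg hr.le (hpos b hb)) ha
  · have h : (1 - S) * ∑' i : ℕ, S ^ i = 1 := mul_neg_geom_series S hS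
    rw [sub_mul, one_mul] at h
    exact hSa ((∑' i : ℕ, S ^ i) a) ▸ DFunLike.congr_fun h a
  · exact DFunLike.congr_fun hcomm.eq a

/-- Applying the resolvent to the invertible defect `l p - Φ p` leaves room to lower the level. -/
theorem IsIrreducibleMap.exists_superharmonic_lt [FiniteDimensional ℂ A] (irr : IsIrreducibleMap Φ)
    (hpos : ∀ a, 0 ≤ a → 0 ≤ Φ a) {l : ℝ} {p : A} (hp : IsSuperharmonic Φ l p)
    (hne : Φ p ≠ l • p) : ∃ l' < l, ∃ q, q ≠ 0 ∧ IsSuperharmonic Φ l' q := by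
  obtain ⟨R, r, hr, hRpos, hR, hRΦ⟩ := exists_positive_resolvent hpos
  have R_ne_zero : ∀ {a}, a ≠ 0 → R a ≠ 0 := fun {a} ha h ↦ ha (by rw [← hR a, h]; simp)
  set y := l • p - Φ p with hy
  have hy0 : 0 ≤ y := sub_nonneg.2 hp.2
  have hRy_superharmonic : IsSuperharmonic Φ r⁻¹ (R y) := by
    refine ⟨hRpos y hy0, (le_inv_smul_iff_of_pos hr).2 ?_⟩
    rwa [← sub_nonneg, hR]
  have hRy_unit : IsUnit (R y) :=
    irr _ _ hRy_superharmonic (R_ne_zero (sub_ne_zero.2 hne.symm))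
  obtain ⟨s, hs, hs_le⟩ :=
    exists_pos_smul_le_of_isUnit hRy_superharmonic.1 hRy_unit (hRpos p hp.1)
  refine ⟨l - s, sub_lt_self l hs, R p, R_ne_zero ?_, hRpos p hp.1, ?_⟩
  · rintro rfl
    simp at hne
  · have hRy : R y = l • R p - Φ (R p) := by
      rw [hy, map_sub, LinearMap.map_smul_of_tower, hRΦ]
    rw [sub_smul]
    exact le_sub_comm.1 (hRy ▸ hs_le)

theorem IsSuperharmonic.level_nonneg (hpos : ∀ a, 0 ≤ a → 0 ≤ Φ a) {l : ℝ} {p : A}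
    (hp : IsSuperharmonic Φ l p) (hne : p ≠ 0) : 0 ≤ l := by
  by_contra! hl
  have h : l • p = 0 := le_antisymm (smul_nonpos_of_nonpos_of_nonneg hl.le hp.1)
    ((hpos p hp.1).trans hp.2)
  exact (smul_eq_zero.1 h).elim hl.ne hne

theorem IsSuperharmonic.smul {l c : ℝ} {p : A} (hp : IsSuperharmonic Φ l p) (hc : 0 ≤ c) :
    IsSuperharmonic Φ l (c • p) := by
  refine ⟨smul_nonneg hc hp.1, ?_⟩
  rw [LinearMap.map_smul_of_tower, smul_comm]
  exact smul_le_smul_of_nonneg_left hp.2 hc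

theorem isCompact_superharmonic [FiniteDimensional ℂ A] (L : ℝ) :
    IsCompact {x : ℝ × A | x.1 ∈ Set.Icc 0 L ∧ ‖x.2‖ = 1 ∧ IsSuperharmonic Φ x.1 x.2} := by
  have : ProperSpace A := FiniteDimensional.proper ℂ A
  have hΦ : Continuous Φ := LinearMap.continuous_of_finiteDimensional Φ
  have hle : {x : ℝ × A | Φ x.2 ≤ x.1 • x.2} = (fun x ↦ x.1 • x.2 - Φ x.2) ⁻¹' {a | 0 ≤ a} := by
    ext x
    simp
  refine Metric.isCompact_of_isClosed_isBounded ?_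
    (((Metric.isBounded_Icc 0 L).prod (Metric.isBounded_sphere (x := (0 : A)) (r := 1))).subset
      fun x hx ↦ ⟨hx.1, by simp [hx.2.1]⟩)
  refine (isClosed_Icc.preimage continuous_fst).inter
    ((isClosed_eq (by fun_prop) (by fun_prop)).inter
    ((CStarAlgebra.isClosed_nonneg.preimage continuous_snd).inter ?_))
  change IsClosed {x : ℝ × A | Φ x.2 ≤ x.1 • x.2}
  exact hle ▸ CStarAlgebra.isClosed_nonneg.preimage (by fun_prop)

theorem exists_minimal_superharmonic_level [Nontrivial A] [FiniteDimensional ℂ A]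
    (hpos : ∀ a, 0 ≤ a → 0 ≤ Φ a) :
    ∃ (l : ℝ) (h : A), h ≠ 0 ∧ IsSuperharmonic Φ l h ∧
      ∀ l' q, q ≠ 0 → IsSuperharmonic Φ l' q → l ≤ l' := by
  have hone : IsSuperharmonic Φ ‖Φ 1‖ 1 := by
    refine ⟨zero_le_one, ?_⟩
    rw [← Algebra.algebraMap_eq_smul_one]
    exact (IsSelfAdjoint.of_nonneg (hpos 1 zero_le_one)).le_algebraMap_norm_self
  obtain ⟨⟨l, h⟩, ⟨hl, hnorm, hh⟩, hmin⟩ :=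
    (isCompact_superharmonic (Φ := Φ) ‖Φ 1‖).exists_isMinOn
      ⟨(‖Φ 1‖, 1), ⟨norm_nonneg _, le_rfl⟩, norm_one, hone⟩ continuous_fst.continuousOn
  refine ⟨l, h, ne_zero_of_norm_ne_zero (hnorm.trans_ne one_ne_zero), hh, fun l' q hq hq' ↦ ?_⟩
  rcases le_total l' ‖Φ 1‖ with hl' | hl'
  · have hnorm_smul : ‖‖q‖⁻¹ • q‖ = 1 := by
      rw [norm_smul, norm_inv, norm_norm, inv_mul_cancel₀ (norm_ne_zero_iff.2 hq)]
    exact hmin (a := (l', ‖q‖⁻¹ • q)) ⟨⟨hq'.level_nonneg hpos hq, hl'⟩, hnorm_smul,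
      hq'.smul (inv_nonneg.2 (norm_nonneg q))⟩
  · exact hl.2.trans hl'

/-- The Perron–Frobenius level is the smallest one with a nonzero superharmonic element; there every
superharmonic element is harmonic, since otherwise the level could be lowered. -/
theorem IsIrreducibleMap.exists_eigenvector_isRecurrent [Nontrivial A] [FiniteDimensional ℂ A]
    (irr : IsIrreducibleMap Φ) (hpos : ∀ a, 0 ≤ a → 0 ≤ Φ a) :
    ∃ (l : ℝ) (h : A), 0 ≤ h ∧ IsUnit h ∧ Φ h = l • h ∧ IsRecurrent Φ l := by
  obtain ⟨l, h, hne, hh, hmin⟩ := exists_minimal_superharmonic_level hpos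
  have hrec : IsRecurrent Φ l := by
    intro p hp
    by_contra hcon
    obtain ⟨l', hl', q, hq, hq'⟩ := irr.exists_superharmonic_lt hpos hp hcon
    exact (hmin l' q hq hq').not_gt hl'
  exact ⟨l, h, hh.1, irr l h hh hne, hrec h hh, hrec⟩

end PerronFrobenius

theorem finite_of_orthonormal_card_le {V : Type*} [AddCommGroup V] [Module ℂ V]
    (core : InnerProductSpace.Core ℂ V) (K : ℕ)
    (hK : ∀ (N : ℕ) (v : Fin N → V),
      (∀ i j, core.inner (v i) (v j) = if i = j then 1 else 0) → N ≤ K) :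
    Module.Finite ℂ V := by
  let _ : NormedAddCommGroup V := core.toNormedAddCommGroup
  let _ : InnerProductSpace ℂ V := .ofCore core.toCore
  have hrank : Module.rank ℂ V ≤ K := by
    refine rank_le fun s hs ↦ ?_
    let W : Submodule ℂ V := Submodule.span ℂ (Set.range ((↑) : s → V))
    have hW : Module.finrank ℂ W = s.card := by
      rw [finrank_span_eq_card hs, Fintype.card_coe]
    have : FiniteDimensional ℂ W := FiniteDimensional.span_of_finite ℂ (Set.finite_range _)
    exact hW ▸ hK _ (fun i ↦ (stdOrthonormalBasis ℂ W i : V))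
      (orthonormal_iff_ite.1 (stdOrthonormalBasis ℂ W).orthonormal)
  exact Module.rank_lt_aleph0_iff.1 (hrank.trans_lt Cardinal.natCast_lt_aleph0)

/-! ### Order structure on endomorphisms in a C*-category -/

section CStarCategory

variable {C : Type u} [Category.{v} C] [Preadditive C] [Linear ℂ C]

theorem isIso_of_forall_comp_eq_zero {X : C} [Module.Finite ℂ (X ⟶ X)] {b : X ⟶ X}
    (hb : ∀ x : X ⟶ X, b ≫ x = 0 → x = 0) : IsIso b := by
  have : FiniteDimensional ℂ (End X) := inferInstanceAs (Module.Finite ℂ (X ⟶ X))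
  have : IsArtinianRing (End X) := IsArtinianRing.of_finite ℂ (End X)
  refine (isUnit_iff_isIso b).1 ((IsArtinianRing.isUnit_iff_isRightRegular (R := End X)).2 ?_)
  exact isRightRegular_of_non_zero_divisor _ hb

variable [CStarCategory C]

noncomputable instance homNormedAddCommGroup (X Y : C) : NormedAddCommGroup (X ⟶ Y) :=
  .ofCore (CStarCategory.homNorm_core X Y)

noncomputable instance homNormedSpace (X Y : C) : NormedSpace ℂ (X ⟶ Y) :=
  .ofCore (CStarCategory.homNorm_core X Y)

theorem norm_dag_comp {X Y : C} (f : X ⟶ Y) : ‖dag f ≫ f‖ = ‖f‖ ^ 2 := by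
  have norm_sq_le {X Y : C} (g : X ⟶ Y) : ‖g‖ ^ 2 ≤ ‖g‖ * ‖dag g‖ :=
    norm_comp_dag g ▸ norm_comp_le g (dag g)
  have h := norm_comp_dag (dag f)
  have hf := norm_sq_le f
  have hf' := norm_sq_le (dag f)
  rw [dag_dag] at h hf'
  rw [h]
  nlinarith [norm_nonneg f, norm_nonneg (dag f)]

theorem eq_zero_of_comp_dag {X Y : C} {f : X ⟶ Y} (h : f ≫ dag f = 0) : f = 0 := by
  rw [← norm_eq_zero, norm_comp_dag] at h
  exact norm_eq_zero.1 (pow_eq_zero_iff two_ne_zero |>.1 h)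

theorem eq_zero_of_dag_comp {X Y : C} {f : X ⟶ Y} (h : dag f ≫ f = 0) : f = 0 := by
  rw [← norm_eq_zero, norm_dag_comp] at h
  exact norm_eq_zero.1 (pow_eq_zero_iff two_ne_zero |>.1 h)

theorem dag_zero (X Y : C) : dag (0 : X ⟶ Y) = 0 := by
  simpa using dag_smul (0 : ℂ) (0 : X ⟶ Y)

theorem dag_neg {X Y : C} (f : X ⟶ Y) : dag (-f) = -dag f := by
  simpa using dag_smul (-1 : ℂ) f

theorem dag_sub {X Y : C} (f g : X ⟶ Y) : dag (f - g) = dag f - dag g := by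
  rw [sub_eq_add_neg, dag_add, dag_neg, sub_eq_add_neg]

instance endStarRing (X : C) : StarRing (End X) where
  star a := dag a.asHom
  star_involutive := dag_dag
  star_mul a b := dag_comp b.asHom a.asHom
  star_add := dag_add

noncomputable instance endNormedRing (X : C) : NormedRing (End X) :=
  { homNormedAddCommGroup X X, (inferInstance : Ring (End X)) with
    norm_mul_le := fun a b ↦ (norm_comp_le b.asHom a.asHom).trans_eq (mul_comm _ _) }

noncomputable instance endCStarAlgebra (X : C) : CStarAlgebra (End X) where
  complete := (CStarCategory.complete X X).complete
  norm_mul_self_le a := ((norm_comp_dag a.asHom).trans (sq _)).ge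
  toAlgebra := inferInstance
  norm_smul_le c a := norm_smul_le c a.asHom
  star_smul := dag_smul

noncomputable instance endPartialOrder (X : C) : PartialOrder (End X) :=
  CStarAlgebra.spectralOrder (End X)

instance endStarOrderedRing (X : C) : StarOrderedRing (End X) :=
  CStarAlgebra.spectralOrderedRing (End X)

noncomputable instance homPartialOrder (X : C) : PartialOrder (X ⟶ X) :=
  endPartialOrder X

instance homIsOrderedAddMonoid (X : C) : IsOrderedAddMonoid (X ⟶ X) :=
  inferInstanceAs (IsOrderedAddMonoid (End X))

theorem nonneg_iff {X : C} {a : X ⟶ X} : 0 ≤ a ↔ ∃ t : X ⟶ X, a = t ≫ dag t :=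
  CStarAlgebra.nonneg_iff_eq_star_mul_self (A := End X)

theorem comp_dag_nonneg {X Y : C} (f : X ⟶ Y) : 0 ≤ f ≫ dag f :=
  nonneg_iff.2 (CStarCategory.comp_dag_positive f)

theorem dag_comp_nonneg {X Y : C} (f : X ⟶ Y) : 0 ≤ dag f ≫ f := by
  simpa only [dag_dag] using comp_dag_nonneg (dag f)

theorem dag_eq_of_nonneg {X : C} {a : X ⟶ X} (ha : 0 ≤ a) : dag a = a :=
  (IsSelfAdjoint.of_nonneg (R := End X) ha).star_eq

theorem dag_comp_comp_nonneg {X Y : C} {a : X ⟶ X} (ha : 0 ≤ a) (f : X ⟶ Y) :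
    0 ≤ dag f ≫ a ≫ f := by
  obtain ⟨t, rfl⟩ := nonneg_iff.1 ha
  simpa only [dag_comp, dag_dag, Category.assoc] using dag_comp_nonneg (dag t ≫ f)

theorem exists_iso_sqrt_of_nonneg {X : C} {b : X ⟶ X} (hb : 0 ≤ b) [IsIso b] :
    ∃ w : X ≅ X, dag w.hom = w.hom ∧ w.hom ≫ w.hom = b := by
  have hunit : IsUnit (CFC.sqrt (End.of b)) :=
    (CFC.isUnit_sqrt_iff (End.of b) hb).2 ((isUnit_iff_isIso b).2 inferInstance)
  have : IsIso (CFC.sqrt (End.of b)).asHom := (isUnit_iff_isIso _).1 hunit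
  exact ⟨asIso (CFC.sqrt (End.of b)).asHom, dag_eq_of_nonneg (CFC.sqrt_nonneg (End.of b)),
    CFC.sqrt_mul_sqrt_self (End.of b) hb⟩

/-- The eigenvector is given as a square `t ≫ t`, so that conjugating by `t` turns it into the
identity. -/
theorem exists_iso_eigenvector_isRecurrent {X : C} [Module.Finite ℂ (X ⟶ X)] (hX : 𝟙 X ≠ 0)
    {Φ : (X ⟶ X) →ₗ[ℂ] (X ⟶ X)} (hpos : ∀ a, 0 ≤ a → 0 ≤ Φ a)
    (irr : ∀ (l : ℝ) (p : X ⟶ X), IsSuperharmonic Φ (l : ℂ) p → p ≠ 0 → IsIso p) :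
    ∃ (t : X ≅ X) (l : ℝ), dag t.hom = t.hom ∧
      Φ (t.hom ≫ t.hom) = (l : ℂ) • (t.hom ≫ t.hom) ∧ IsRecurrent Φ (l : ℂ) := by
  have : Nontrivial (End X) := ⟨⟨𝟙 X, 0, hX⟩⟩
  have : FiniteDimensional ℂ (End X) := inferInstanceAs (Module.Finite ℂ (X ⟶ X))
  let Ψ : End X →ₗ[ℂ] End X := Φ
  have coe_smul (l : ℝ) (p : End X) : (l : ℂ) • p.asHom = l • p := Complex.coe_smul l p
  have hirr : IsIrreducibleMap Ψ := fun l p hp hne ↦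
    (isUnit_iff_isIso p.asHom).2 (irr l p ⟨hp.1, hp.2.trans_eq (coe_smul l p).symm⟩ hne)
  obtain ⟨l, h, h0, hu, hl, hrec⟩ := hirr.exists_eigenvector_isRecurrent hpos
  have : IsIso h.asHom := (isUnit_iff_isIso _).1 hu
  obtain ⟨t, ht, hth⟩ := exists_iso_sqrt_of_nonneg (b := h.asHom) h0
  refine ⟨t, l, ht, ?_, fun p hp ↦ ?_⟩
  · rw [hth]
    exact hl.trans (coe_smul l h).symm
  · exact (hrec p ⟨hp.1, hp.2.trans_eq (coe_smul l p)⟩).trans (coe_smul l p).symm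

end CStarCategory

/-! ### Finite-dimensionality of endomorphism spaces of rigid objects -/

section CStarCategory

variable {C : Type u} [Category.{v} C] [Preadditive C] [Linear ℂ C] [CStarCategory C]

theorem dag_sum {κ : Type*} {X Y : C} (s : Finset κ) (f : κ → (X ⟶ Y)) :
    dag (∑ i ∈ s, f i) = ∑ i ∈ s, dag (f i) :=
  map_sum (AddMonoidHom.mk' dag dag_add) f s

theorem nonneg_of_comp_self {X : C} {p : X ⟶ X} (hdag : dag p = p) (hp : p ≫ p = p) : 0 ≤ p := by
  simpa only [hdag, hp] using comp_dag_nonneg p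

theorem sum_dag_comp_le_id {κ : Type*} [Fintype κ] [DecidableEq κ] {W Z : C} {f : κ → (W ⟶ Z)}
    (hf : ∀ i j, f i ≫ dag (f j) = if i = j then 𝟙 W else 0) :
    ∑ i, dag (f i) ≫ f i ≤ 𝟙 Z := by
  set Q := ∑ i, dag (f i) ≫ f i with hQ
  have hQ_dag : dag Q = Q := by simp only [hQ, dag_sum, dag_comp, dag_dag]
  have hQ_comp : Q ≫ Q = Q := by
    simp [hQ, Preadditive.sum_comp, Preadditive.comp_sum, reassoc_of% hf, ite_comp, comp_ite]
  refine sub_nonneg.1 (nonneg_of_comp_self ?_ ?_)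
  · rw [dag_sub, dag_id, hQ_dag]
  · simp [Preadditive.sub_comp, Preadditive.comp_sub, hQ_comp]

theorem norm_eq_one_of_comp_dag {W Z : C} (hW : 𝟙 W ≠ 0) {f : W ⟶ Z} (hf : f ≫ dag f = 𝟙 W) :
    ‖f‖ = 1 := by
  have hid : ‖𝟙 W‖ = 1 := by
    have h := norm_comp_dag (𝟙 W)
    rw [dag_id, Category.comp_id, sq] at h
    exact (mul_eq_left₀ (norm_ne_zero_iff.2 hW)).1 h.symm
  have h := norm_comp_dag f
  rwa [hf, hid, eq_comm, pow_eq_one_iff_of_nonneg (norm_nonneg f) two_ne_zero] at h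

end CStarCategory

section Unit

variable {C : Type u} [Category.{v} C] [Preadditive C] [Linear ℂ C] [MonoidalCategory C]

theorem id_unit_ne_zero (hC : SimpleUnit C) : 𝟙 (𝟙_ C) ≠ 0 := by
  intro h
  have : Subsingleton (𝟙_ C ⟶ 𝟙_ C) := subsingleton_of_forall_eq 0 fun a ↦ by
    rw [← Category.comp_id a, h, Limits.comp_zero]
  exact zero_ne_one ((Module.finrank_zero_of_subsingleton (R := ℂ)).symm.trans hC)

/-- The identification of the endomorphisms of a simple tensor unit with the complex numbers. -/
noncomputable def unitScalar (hC : SimpleUnit C) : (𝟙_ C ⟶ 𝟙_ C) ≃ₗ[ℂ] ℂ :=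
  (LinearEquiv.ofBijective (LinearMap.toSpanSingleton ℂ (𝟙_ C ⟶ 𝟙_ C) (𝟙 (𝟙_ C)))
    ⟨smul_left_injective ℂ (id_unit_ne_zero hC),
      (finrank_eq_one_iff_of_nonzero' (𝟙 (𝟙_ C)) (id_unit_ne_zero hC)).1 hC⟩).symm

theorem unitScalar_smul_id (hC : SimpleUnit C) (f : 𝟙_ C ⟶ 𝟙_ C) :
    unitScalar hC f • 𝟙 (𝟙_ C) = f :=
  (unitScalar hC).symm_apply_apply f

theorem unitScalar_id (hC : SimpleUnit C) : unitScalar hC (𝟙 (𝟙_ C)) = 1 := by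
  rw [← LinearEquiv.eq_symm_apply]
  exact (one_smul ℂ (𝟙 (𝟙_ C))).symm

theorem unitScalar_comp (hC : SimpleUnit C) (f g : 𝟙_ C ⟶ 𝟙_ C) :
    unitScalar hC (f ≫ g) = unitScalar hC f * unitScalar hC g := by
  rw [← unitScalar_smul_id hC f, ← unitScalar_smul_id hC g]
  simp [unitScalar_id, mul_comm]

variable [CStarCategory C]

theorem unitScalar_dag (hC : SimpleUnit C) (f : 𝟙_ C ⟶ 𝟙_ C) :
    unitScalar hC (dag f) = conj (unitScalar hC f) := by
  conv_lhs => rw [← unitScalar_smul_id hC f]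
  rw [dag_smul, dag_id, map_smul, unitScalar_id, smul_eq_mul, mul_one]

open scoped ComplexOrder in
theorem unitScalar_nonneg (hC : SimpleUnit C) {f : 𝟙_ C ⟶ 𝟙_ C} (hf : 0 ≤ f) :
    0 ≤ unitScalar hC f := by
  obtain ⟨t, rfl⟩ := nonneg_iff.1 hf
  rw [unitScalar_comp, unitScalar_dag]
  exact mul_star_self_nonneg (unitScalar hC t)

open scoped ComplexOrder in
/-- The inner product `⟨f, g⟩ = f* g` on the morphisms out of a simple tensor unit. -/
@[reducible] noncomputable def unitHomInnerCore (hC : SimpleUnit C) (Z : C) :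
    InnerProductSpace.Core ℂ (𝟙_ C ⟶ Z) where
  inner f g := unitScalar hC (g ≫ dag f)
  conj_inner_symm f g := by rw [← unitScalar_dag, dag_comp, dag_dag]
  re_inner_nonneg f := (Complex.nonneg_iff.1 (unitScalar_nonneg hC (comp_dag_nonneg f))).1
  add_left f g h := by rw [dag_add, Preadditive.comp_add, map_add]
  smul_left f g c := by rw [dag_smul, Linear.comp_smul, map_smul, smul_eq_mul]
  definite f hf := eq_zero_of_comp_dag ((unitScalar hC).map_eq_zero_iff.1 hf)

open scoped ComplexOrder in
/-- Bessel's inequality bounds the trace of the range projections of an orthonormal family, and each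
of these has trace at least `1 / K`. -/
theorem finite_unitHom_of_positive_functional (hC : SimpleUnit C) {Z : C} (τ : (Z ⟶ Z) →ₗ[ℂ] ℂ)
    (hτ : ∀ a, 0 ≤ a → 0 ≤ τ a) {K : ℝ} (hK : 0 ≤ K)
    (hτK : ∀ f : 𝟙_ C ⟶ Z, ‖f‖ ^ 2 ≤ K * (τ (dag f ≫ f)).re) :
    Module.Finite ℂ (𝟙_ C ⟶ Z) := by
  refine finite_of_orthonormal_card_le (unitHomInnerCore hC Z) ⌈K * (τ (𝟙 Z)).re⌉₊ fun N f hf ↦ ?_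
  have horth (i j : Fin N) : f i ≫ dag (f j) = if i = j then 𝟙 (𝟙_ C) else 0 := by
    have h : unitScalar hC (f i ≫ dag (f j)) = if j = i then 1 else 0 := hf j i
    rw [← unitScalar_smul_id hC (f i ≫ dag (f j)), h]
    simp [ite_smul, eq_comm]
  have hone (i : Fin N) : 1 ≤ K * (τ (dag (f i) ≫ f i)).re := by
    have h := hτK (f i)
    rwa [norm_eq_one_of_comp_dag (id_unit_ne_zero hC) (by simp [horth]), one_pow] at h
  have hbessel : (τ (∑ i, dag (f i) ≫ f i)).re ≤ (τ (𝟙 Z)).re := by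
    have h := (Complex.nonneg_iff.1 (hτ _ (sub_nonneg.2 (sum_dag_comp_le_id horth)))).1
    rwa [map_sub, Complex.sub_re, sub_nonneg] at h
  have hN : (N : ℝ) ≤ K * (τ (𝟙 Z)).re :=
    calc (N : ℝ) = ∑ _ : Fin N, (1 : ℝ) := by simp
      _ ≤ ∑ i, K * (τ (dag (f i) ≫ f i)).re := Finset.sum_le_sum fun i _ ↦ hone i
      _ = K * (τ (∑ i, dag (f i) ≫ f i)).re := by rw [map_sum, Complex.re_sum, Finset.mul_sum]
      _ ≤ K * (τ (𝟙 Z)).re := mul_le_mul_of_nonneg_left hbessel hK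
  exact_mod_cast hN.trans (Nat.le_ceil _)

end Unit

section Bending

variable {C : Type u} [Category.{v} C] [MonoidalCategory C] (X Y : C) [ExactPairing X Y]

/-- The morphism obtained from `f : 𝟙 ⟶ X ⊗ Y` by bending both tensor factors down. -/
def bendDown (f : 𝟙_ C ⟶ X ⊗ Y) : Y ⊗ 𝟙_ C ⊗ X ⟶ 𝟙_ C :=
  (tensorLeftHomEquiv _ X Y _).symm ((tensorRightHomEquiv _ X Y _).symm f ≫ (ρ_ X).inv)

theorem exists_bendDown_eq :
    ∃ u : Y ⊗ (X ⊗ Y) ⊗ X ⟶ 𝟙_ C, ∀ f, bendDown X Y f = Y ◁ f ▷ X ≫ u := by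
  refine ⟨Y ◁ ((α_ X Y X).hom ≫ X ◁ ε_ X Y ≫ (ρ_ X).hom ≫ (ρ_ X).inv) ≫ (α_ Y X (𝟙_ C)).inv ≫
    ε_ X Y ▷ 𝟙_ C ≫ (λ_ (𝟙_ C)).hom, fun f ↦ ?_⟩
  simp [bendDown, tensorLeftHomEquiv, tensorRightHomEquiv]

end Bending

section Duals

variable {C : Type u} [Category.{v} C] [Preadditive C] [Linear ℂ C]
  [MonoidalCategory C] [MonoidalPreadditive C] [MonoidalLinear ℂ C] [CStarTensorCategory C]

theorem dag_whiskerLeft (X : C) {Y Z : C} (f : Y ⟶ Z) : dag (X ◁ f) = X ◁ dag f := by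
  rw [← id_tensorHom, dag_tensorHom, dag_id, id_tensorHom]

theorem dag_whiskerRight {Y Z : C} (f : Y ⟶ Z) (X : C) : dag (f ▷ X) = dag f ▷ X := by
  rw [← tensorHom_id, dag_tensorHom, dag_id, tensorHom_id]

theorem norm_whiskerLeft_whiskerRight_sq (hC : SimpleUnit C) (X Y : C) {W : C} (g : W ⟶ 𝟙_ C) :
    ‖(X ◁ g) ▷ Y‖ ^ 2 = ‖𝟙 ((X ⊗ 𝟙_ C) ⊗ Y)‖ * ‖unitScalar hC (dag g ≫ g)‖ := by
  rw [← norm_dag_comp, dag_whiskerRight, dag_whiskerLeft, ← comp_whiskerRight, ← whiskerLeft_comp]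
  conv_lhs => rw [← unitScalar_smul_id hC (dag g ≫ g)]
  rw [MonoidalLinear.whiskerLeft_smul, MonoidalLinear.smul_whiskerRight, whiskerLeft_id,
    id_whiskerRight, norm_smul, mul_comm]

/-- The linear functional `a ↦ u* (1 ⊗ a ⊗ 1) u`. -/
noncomputable def whiskeredVectorFunctional (hC : SimpleUnit C) {X Y Z : C} (u : Y ⊗ Z ⊗ X ⟶ 𝟙_ C) :
    (Z ⟶ Z) →ₗ[ℂ] ℂ where
  toFun a := unitScalar hC (dag u ≫ Y ◁ a ▷ X ≫ u)
  map_add' a b := by simp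
  map_smul' c a := by simp

section

variable (X Y : C) [ExactPairing X Y]

theorem exists_sq_norm_le_bendDown (hC : SimpleUnit C) : ∃ K : ℝ, 0 ≤ K ∧
    ∀ f, ‖f‖ ^ 2 ≤ K * ‖unitScalar hC (dag (bendDown X Y f) ≫ bendDown X Y f)‖ := by
  obtain ⟨p, q, hpq⟩ : ∃ (p : 𝟙_ C ⟶ (X ⊗ Y ⊗ 𝟙_ C ⊗ X) ⊗ Y) (q : (X ⊗ 𝟙_ C) ⊗ Y ⟶ X ⊗ Y),
      ∀ f, f = p ≫ (X ◁ bendDown X Y f) ▷ Y ≫ q := by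
    refine ⟨(ρ_ (𝟙_ C)).inv ≫ 𝟙_ C ◁ η_ X Y ≫ (α_ (𝟙_ C) X Y).inv ≫
      ((λ_ (𝟙_ C ⊗ X)).inv ≫ η_ X Y ▷ (𝟙_ C ⊗ X) ≫ (α_ X Y (𝟙_ C ⊗ X)).hom) ▷ Y,
      (ρ_ X).hom ▷ Y, fun f ↦ ?_⟩
    calc f = tensorRightHomEquiv _ X Y _ (tensorLeftHomEquiv _ X Y _ (bendDown X Y f) ≫
          (ρ_ X).hom) := by simp [bendDown]
      _ = _ := by simp [tensorLeftHomEquiv, tensorRightHomEquiv]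
  refine ⟨‖p‖ ^ 2 * ‖𝟙 ((X ⊗ 𝟙_ C) ⊗ Y)‖ * ‖q‖ ^ 2, by positivity, fun f ↦ ?_⟩
  have hnorm : ‖f‖ ≤ ‖p‖ * (‖(X ◁ bendDown X Y f) ▷ Y‖ * ‖q‖) := by
    conv_lhs => rw [hpq f]
    exact (norm_comp_le _ _).trans (by gcongr; exact norm_comp_le _ _)
  calc ‖f‖ ^ 2 ≤ (‖p‖ * (‖(X ◁ bendDown X Y f) ▷ Y‖ * ‖q‖)) ^ 2 := by gcongr
    _ = ‖p‖ ^ 2 * ‖(X ◁ bendDown X Y f) ▷ Y‖ ^ 2 * ‖q‖ ^ 2 := by ring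
    _ = _ := by rw [norm_whiskerLeft_whiskerRight_sq hC]; ring

open scoped ComplexOrder in
theorem finite_unitHom_tensor (hC : SimpleUnit C) : Module.Finite ℂ (𝟙_ C ⟶ X ⊗ Y) := by
  obtain ⟨u, hu⟩ := exists_bendDown_eq X Y
  obtain ⟨K, hK0, hK⟩ := exists_sq_norm_le_bendDown X Y hC
  let τ := whiskeredVectorFunctional hC u
  have hτ_comp {W : C} (f : W ⟶ X ⊗ Y) :
      τ (dag f ≫ f) = unitScalar hC (dag (Y ◁ f ▷ X ≫ u) ≫ Y ◁ f ▷ X ≫ u) := by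
    simp [τ, whiskeredVectorFunctional, dag_comp, dag_whiskerLeft, dag_whiskerRight]
  have hτ (a : X ⊗ Y ⟶ X ⊗ Y) (ha : 0 ≤ a) : 0 ≤ τ a := by
    obtain ⟨t, rfl⟩ := nonneg_iff.1 ha
    have h := hτ_comp (dag t)
    rw [dag_dag] at h
    exact h ▸ unitScalar_nonneg hC (dag_comp_nonneg _)
  refine finite_unitHom_of_positive_functional hC τ hτ hK0 fun f ↦ (hK f).trans_eq ?_
  rw [hτ_comp, ← hu, ← Complex.re_eq_norm.2 (unitScalar_nonneg hC (dag_comp_nonneg _))]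

end

theorem finite_end_of_exactPairing (hC : SimpleUnit C) (X Y : C) [ExactPairing X Y] :
    Module.Finite ℂ (X ⟶ X) := by
  have := finite_unitHom_tensor X Y hC
  let bendUp : (X ⟶ X) →ₗ[ℂ] (𝟙_ C ⟶ X ⊗ Y) :=
    { toFun := fun T ↦ tensorRightHomEquiv _ X Y _ ((λ_ X).hom ≫ T)
      map_add' := by simp [tensorRightHomEquiv]
      map_smul' := by simp [tensorRightHomEquiv, MonoidalLinear.smul_whiskerRight] }
  exact Module.Finite.of_injective bendUp
    ((tensorRightHomEquiv _ X Y _).injective.comp fun S T h ↦ (cancel_epi (λ_ X).hom).1 h)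

end Duals

/-! ### Haploid C*-Frobenius algebras -/

section Haploid

variable {C : Type u} [Category.{v} C] [Preadditive C] [Linear ℂ C] [MonoidalCategory C]
  [MonoidalPreadditive C] {A B : Mon C}

theorem IsHaploid.unit_ne_zero (hA : IsHaploid A) : η[A.X] ≠ 0 := by
  intro h
  have hid : 𝟙 A.X = 0 := by
    rw [← (λ_ A.X).inv_hom_id, ← MonObj.one_mul A.X, h]
    simp
  have : Subsingleton (𝟙_ C ⟶ A.X) := subsingleton_of_forall_eq 0 fun f ↦ by
    rw [← Category.comp_id f, hid, Limits.comp_zero]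
  exact one_ne_zero (hA.symm.trans Module.finrank_zero_of_subsingleton)

theorem IsHaploid.id_ne_zero (hA : IsHaploid A) : 𝟙 A.X ≠ 0 := fun h ↦
  hA.unit_ne_zero (by rw [← Category.comp_id η[A.X], h, Limits.comp_zero])

theorem IsHaploid.mul_ne_zero (hA : IsHaploid A) : μ[A.X] ≠ 0 := fun h ↦
  hA.id_ne_zero (by rw [← (ρ_ A.X).inv_hom_id, ← MonObj.mul_one A.X, h]; simp)

theorem IsHaploid.exists_eq_smul_unit (hA : IsHaploid A) (f : 𝟙_ C ⟶ A.X) :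
    ∃ c : ℂ, f = c • η[A.X] :=
  let ⟨c, hc⟩ := (finrank_eq_one_iff_of_nonzero' η[A.X] hA.unit_ne_zero).1 hA f
  ⟨c, hc.symm⟩

variable [MonoidalLinear ℂ C]

theorem IsHaploid.exists_eq_smul_id (hA : IsHaploid A) {T : A.X ⟶ A.X}
    (hT : μ[A.X] ≫ T = A.X ◁ T ≫ μ[A.X]) : ∃ c : ℂ, T = c • 𝟙 A.X := by
  obtain ⟨c, hc⟩ := hA.exists_eq_smul_unit (η[A.X] ≫ T)
  refine ⟨c, ?_⟩
  calc T = (ρ_ A.X).inv ≫ A.X ◁ η[A.X] ≫ μ[A.X] ≫ T := by simp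
    _ = (ρ_ A.X).inv ≫ A.X ◁ (η[A.X] ≫ T) ≫ μ[A.X] := by rw [hT]; simp
    _ = c • 𝟙 A.X := by rw [hc]; simp [MonoidalLinear.whiskerLeft_smul]

theorem IsHaploid.exists_eq_smul_of_intertwines (hB : IsHaploid B) {F S : A.X ⟶ B.X}
    (hF : μ[A.X] ≫ F = (F ⊗ₘ S) ≫ μ[B.X]) : ∃ c : ℂ, F = c • S := by
  obtain ⟨c, hc⟩ := hB.exists_eq_smul_unit (η[A.X] ≫ F)
  refine ⟨c, ?_⟩
  calc F = (λ_ A.X).inv ≫ η[A.X] ▷ A.X ≫ μ[A.X] ≫ F := by simp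
    _ = (λ_ A.X).inv ≫ (η[A.X] ≫ F) ▷ A.X ≫ B.X ◁ S ≫ μ[B.X] := by
        rw [hF, MonoidalCategory.tensorHom_def]; simp
    _ = c • ((λ_ A.X).inv ≫ (𝟙_ C) ◁ S ≫ η[B.X] ▷ B.X ≫ μ[B.X]) := by
        rw [hc, ← whisker_exchange_assoc]; simp [MonoidalLinear.smul_whiskerRight]
    _ = c • S := by simp

end Haploid

section FrobeniusAlgebras

variable {C : Type u} [Category.{v} C] [Preadditive C] [Linear ℂ C]
  [MonoidalCategory C] [MonoidalPreadditive C] [MonoidalLinear ℂ C] [CStarTensorCategory C]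

theorem dag_associator_inv (X Y Z : C) : dag (α_ X Y Z).inv = (α_ X Y Z).hom := by
  rw [← dag_associator_hom, dag_dag]

section Comultiplication

variable (A : Mon C)

theorem dag_mul_assoc : dag μ[A.X] ≫ dag μ[A.X] ▷ A.X =
    dag μ[A.X] ≫ A.X ◁ dag μ[A.X] ≫ (α_ A.X A.X A.X).inv := by
  simpa only [dag_comp, dag_whiskerLeft, dag_whiskerRight, dag_associator_hom, Category.assoc]
    using congrArg dag (MonObj.mul_assoc A.X)

theorem dag_mul_counit_left : dag μ[A.X] ≫ dag η[A.X] ▷ A.X = (λ_ A.X).inv := by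
  rw [← dag_leftUnitor_hom, ← MonObj.one_mul, dag_comp, dag_whiskerRight]

theorem dag_mul_counit_right : dag μ[A.X] ≫ A.X ◁ dag η[A.X] = (ρ_ A.X).inv := by
  rw [← dag_rightUnitor_hom, ← MonObj.mul_one, dag_comp, dag_whiskerLeft]

end Comultiplication

section Frobenius

variable {A B : Mon C}

/-- The self-duality of a C*-Frobenius algebra, with evaluation `ι* m` and coevaluation `m* ι`. -/
@[reducible] def IsCStarFrobenius.exactPairing (hA : IsCStarFrobenius A) :
    ExactPairing A.X A.X where
  coevaluation' := η[A.X] ≫ dag μ[A.X]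
  evaluation' := μ[A.X] ≫ dag η[A.X]
  coevaluation_evaluation' := by
    calc _ = A.X ◁ η[A.X] ≫ (A.X ◁ dag μ[A.X] ≫ (α_ _ _ _).inv ≫ μ[A.X] ▷ A.X) ≫
          dag η[A.X] ▷ A.X := by simp
      _ = _ := by rw [hA.1, Category.assoc, dag_mul_counit_left, MonObj.mul_one_assoc]
  evaluation_coevaluation' := by
    calc _ = η[A.X] ▷ A.X ≫ (dag μ[A.X] ▷ A.X ≫ (α_ _ _ _).hom ≫ A.X ◁ μ[A.X]) ≫
          A.X ◁ dag η[A.X] := by simp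
      _ = _ := by rw [← hA.2, Category.assoc, dag_mul_counit_right, MonObj.one_mul_assoc]

theorem IsCStarFrobenius.isRigid (hA : IsCStarFrobenius A) (hn : IsNormalized A) : IsRigid A :=
  ⟨dag η[A.X], hn, hA.exactPairing, rfl⟩

theorem IsCStarFrobenius.dag_mul_comp_tensor_comp_mul_intertwines (hA : IsCStarFrobenius A)
    {S : A.X ⟶ B.X} (hS : μ[A.X] ≫ S = (S ⊗ₘ S) ≫ μ[B.X]) (Z : A.X ⟶ B.X) :
    μ[A.X] ≫ dag μ[A.X] ≫ (Z ⊗ₘ S) ≫ μ[B.X] =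
      ((dag μ[A.X] ≫ (Z ⊗ₘ S) ≫ μ[B.X]) ⊗ₘ S) ≫ μ[B.X] := by
  calc _ = dag μ[A.X] ▷ A.X ≫ (α_ _ _ _).hom ≫ A.X ◁ μ[A.X] ≫ (Z ⊗ₘ S) ≫ μ[B.X] := by
        rw [← Category.assoc, hA.2]; simp
    _ = dag μ[A.X] ▷ A.X ≫ (α_ _ _ _).hom ≫ (Z ⊗ₘ ((S ⊗ₘ S) ≫ μ[B.X])) ≫ μ[B.X] := by
        rw [whiskerLeft_comp_tensorHom_assoc, hS]
    _ = dag μ[A.X] ▷ A.X ≫ (α_ _ _ _).hom ≫ (Z ⊗ₘ (S ⊗ₘ S)) ≫ B.X ◁ μ[B.X] ≫ μ[B.X] := by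
        rw [tensorHom_comp_whiskerLeft_assoc]
    _ = dag μ[A.X] ▷ A.X ≫ ((Z ⊗ₘ S) ⊗ₘ S) ≫ μ[B.X] ▷ B.X ≫ μ[B.X] := by
        rw [MonObj.mul_assoc, associator_naturality_assoc]
    _ = _ := by
        rw [tensorHom_comp_whiskerRight_assoc, whiskerRight_comp_tensorHom_assoc]

theorem IsCStarFrobenius.exists_dag_mul_comp_tensor_comp_mul_eq_smul (hA : IsCStarFrobenius A)
    (hB : IsHaploid B) {S : A.X ⟶ B.X} (hS : μ[A.X] ≫ S = (S ⊗ₘ S) ≫ μ[B.X])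
    (Z : A.X ⟶ B.X) : ∃ c : ℂ, dag μ[A.X] ≫ (Z ⊗ₘ S) ≫ μ[B.X] = c • S :=
  hB.exists_eq_smul_of_intertwines (hA.dag_mul_comp_tensor_comp_mul_intertwines hS Z)

theorem IsCStarFrobenius.exists_dag_mul_comp_whiskerRight_comp_mul_eq_smul_id
    (hA : IsCStarFrobenius A) (hA' : IsHaploid A) (T : A.X ⟶ A.X) :
    ∃ c : ℂ, dag μ[A.X] ≫ T ▷ A.X ≫ μ[A.X] = c • 𝟙 A.X := by
  simpa using hA.exists_dag_mul_comp_tensor_comp_mul_eq_smul hA' (S := 𝟙 A.X) (by simp) T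

theorem IsCStarFrobenius.exists_dag_mul_comp_whiskerLeft_comp_mul_eq_smul_id
    (hA : IsCStarFrobenius A) (hA' : IsHaploid A) (T : A.X ⟶ A.X) :
    ∃ c : ℂ, dag μ[A.X] ≫ A.X ◁ T ≫ μ[A.X] = c • 𝟙 A.X := by
  refine hA'.exists_eq_smul_id ?_
  calc μ[A.X] ≫ dag μ[A.X] ≫ A.X ◁ T ≫ μ[A.X]
      = A.X ◁ dag μ[A.X] ≫ (α_ _ _ _).inv ≫ μ[A.X] ▷ A.X ≫ A.X ◁ T ≫ μ[A.X] := by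
        rw [← Category.assoc, ← hA.1]; simp
    _ = A.X ◁ dag μ[A.X] ≫ (α_ _ _ _).inv ≫ (A.X ⊗ A.X) ◁ T ≫ μ[A.X] ▷ A.X ≫ μ[A.X] := by
        rw [whisker_exchange_assoc]
    _ = _ := by rw [MonObj.mul_assoc]; simp

theorem IsCStarFrobenius.isSpecial (hA : IsCStarFrobenius A) (hA' : IsHaploid A) :
    IsSpecial A := by
  simpa [IsSpecial] using hA.exists_dag_mul_comp_whiskerLeft_comp_mul_eq_smul_id hA' (𝟙 A.X)

theorem dag_mul_comp_whiskerLeft_right_comp_mul (T : A.X ⟶ A.X) :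
    dag μ[A.X] ≫ A.X ◁ (dag μ[A.X] ≫ T ▷ A.X ≫ μ[A.X]) ≫ μ[A.X] =
      dag μ[A.X] ≫ (dag μ[A.X] ≫ A.X ◁ T ≫ μ[A.X]) ▷ A.X ≫ μ[A.X] := by
  symm
  calc _ = (dag μ[A.X] ≫ dag μ[A.X] ▷ A.X) ≫ (A.X ◁ T) ▷ A.X ≫ μ[A.X] ▷ A.X ≫ μ[A.X] := by
        simp
    _ = _ := by rw [dag_mul_assoc, MonObj.mul_assoc]; simp

theorem IsCStarFrobenius.dag_mul_comp_whiskerLeft_comp_mul_eq_whiskerRight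
    (hA : IsCStarFrobenius A) (hA' : IsHaploid A) (T : A.X ⟶ A.X) :
    dag μ[A.X] ≫ A.X ◁ T ≫ μ[A.X] = dag μ[A.X] ≫ T ▷ A.X ≫ μ[A.X] := by
  obtain ⟨a, ha⟩ := hA.exists_dag_mul_comp_whiskerRight_comp_mul_eq_smul_id hA' T
  obtain ⟨b, hb⟩ := hA.exists_dag_mul_comp_whiskerLeft_comp_mul_eq_smul_id hA' T
  have hne : dag μ[A.X] ≫ μ[A.X] ≠ 0 := fun h ↦ hA'.mul_ne_zero (eq_zero_of_dag_comp h)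
  have hsmul : a • (dag μ[A.X] ≫ μ[A.X]) = b • (dag μ[A.X] ≫ μ[A.X]) := by
    have := dag_mul_comp_whiskerLeft_right_comp_mul T
    rw [ha, hb, MonoidalLinear.whiskerLeft_smul, MonoidalLinear.smul_whiskerRight] at this
    simpa only [whiskerLeft_id, id_whiskerRight, Linear.smul_comp, Linear.comp_smul,
      Category.id_comp] using this
  rw [ha, hb, smul_left_injective ℂ hne hsmul]

theorem IsCStarFrobenius.isStandard (hA : IsCStarFrobenius A) (hA' : IsHaploid A) :
    IsStandard A := by
  refine ⟨hA.exactPairing, rfl, rfl, fun T ↦ ?_⟩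
  change dag (μ[A.X] ≫ dag η[A.X]) ≫ A.X ◁ T ≫ μ[A.X] ≫ dag η[A.X] =
    (η[A.X] ≫ dag μ[A.X]) ≫ T ▷ A.X ≫ dag (η[A.X] ≫ dag μ[A.X])
  calc _ = η[A.X] ≫ (dag μ[A.X] ≫ A.X ◁ T ≫ μ[A.X]) ≫ dag η[A.X] := by simp [dag_comp, dag_dag]
    _ = η[A.X] ≫ (dag μ[A.X] ≫ T ▷ A.X ≫ μ[A.X]) ≫ dag η[A.X] := by
        rw [hA.dag_mul_comp_whiskerLeft_comp_mul_eq_whiskerRight hA' T]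
    _ = _ := by simp [dag_comp, dag_dag]

theorem IsEquivalence.exists_dag_inv_eq_smul_hom (hA : IsCStarFrobenius A)
    (hB : IsCStarFrobenius B) (hB' : IsHaploid B) {S : A.X ≅ B.X} (hS : IsEquivalence A B S) :
    ∃ k : ℂ, dag S.inv = k • S.hom := by
  obtain ⟨c, hc⟩ := hA.exists_dag_mul_comp_tensor_comp_mul_eq_smul hB' hS.1 (dag S.inv)
  obtain ⟨k, hk⟩ :=
    hB.exists_dag_mul_comp_whiskerLeft_comp_mul_eq_smul_id hB' (dag S.hom ≫ S.hom)
  have hk0 : conj k ≠ 0 := by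
    rw [Ne, map_eq_zero]
    rintro rfl
    have h : B.X ◁ S.hom ≫ μ[B.X] = 0 := eq_zero_of_dag_comp <| by
      rw [zero_smul] at hk
      rw [← hk]
      simp [dag_comp, dag_whiskerLeft]
    exact hB'.mul_ne_zero (by rw [← cancel_epi (B.X ◁ S.hom), h, Limits.comp_zero])
  have hsmul : dag μ[B.X] ≫ (S.inv ⊗ₘ dag S.hom) ≫ μ[A.X] = k • S.inv := by
    calc _ = (dag μ[B.X] ≫ B.X ◁ (dag S.hom ≫ S.hom) ≫ μ[B.X]) ≫ S.inv := by
          simp only [Category.assoc]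
          rw [show μ[B.X] ≫ S.inv = (S.inv ⊗ₘ S.inv) ≫ μ[A.X] from hS.symm.1,
            whiskerLeft_comp_tensorHom_assoc]
          simp
      _ = _ := by rw [hk]; simp
  have hdag : c • S.hom = conj k • dag S.inv := by
    simpa only [dag_smul, dag_comp, dag_tensorHom, dag_dag, Category.assoc, hc]
      using congrArg dag hsmul
  exact ⟨(conj k)⁻¹ * c, by rw [mul_smul, hdag, inv_smul_smul₀ hk0]⟩

theorem IsEquivalence.isUnitary (hA : IsCStarFrobenius A) (hnA : IsNormalized A)
    (hB : IsCStarFrobenius B) (hB' : IsHaploid B) (hnB : IsNormalized B) {S : A.X ≅ B.X}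
    (hS : IsEquivalence A B S) : IsUnitary S.hom := by
  obtain ⟨k, hk⟩ := hS.exists_dag_inv_eq_smul_hom hA hB hB'
  have hinv : S.inv = conj k • dag S.hom := by rw [← dag_dag S.inv, hk, dag_smul]
  have hunit : conj k • 𝟙 (𝟙_ C) = (1 : ℂ) • 𝟙 (𝟙_ C) := by
    calc conj k • 𝟙 (𝟙_ C) = conj k • (η[B.X] ≫ dag η[B.X]) := by rw [show _ = _ from hnB]
      _ = η[A.X] ≫ S.hom ≫ (conj k • dag S.hom) ≫ dag η[A.X] := by
          simp [← hS.2, dag_comp]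
      _ = (1 : ℂ) • 𝟙 (𝟙_ C) := by
          rw [← hinv, S.hom_inv_id_assoc, one_smul]
          exact hnA
  have hid : 𝟙 (𝟙_ C) ≠ 0 := fun h ↦
    hB'.unit_ne_zero (by rw [← Category.id_comp η[B.X], h, Limits.zero_comp])
  rw [smul_left_injective ℂ hid hunit, one_smul] at hinv
  exact ⟨by rw [← hinv, S.hom_inv_id], by rw [← hinv, S.inv_hom_id]⟩

end Frobenius

end FrobeniusAlgebras

/-! ### Free modules and the partial trace -/

section Actions

variable {C : Type u} [Category.{v} C] [MonoidalCategory C]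

/-- An associative action of the algebra `A` on `V`. -/
def IsAction (A : Mon C) {V : C} (n : A.X ⊗ V ⟶ V) : Prop :=
  μ[A.X] ▷ V ≫ n = (α_ A.X A.X V).hom ≫ A.X ◁ n ≫ n

/-- The action on `V ⊗ Y` induced by an action on `V`. -/
def freeAction {X V : C} (Y : C) (n : X ⊗ V ⟶ V) : X ⊗ (V ⊗ Y) ⟶ V ⊗ Y :=
  (α_ X V Y).inv ≫ n ▷ Y

theorem freeAction_whiskerRight_comp {X X' V : C} (Y : C) (f : X' ⟶ X) (n : X ⊗ V ⟶ V) :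
    freeAction Y (f ▷ V ≫ n) = f ▷ (V ⊗ Y) ≫ freeAction Y n := by
  simp [freeAction]

/-- The algebra structure transported along an isomorphism. -/
@[reducible] def transport (A : Mon C) {X : C} (w : A.X ≅ X) : Mon C :=
  { X := X, mon := MonObj.ofIso w }

theorem isEquivalence_transport (A : Mon C) {X : C} (w : A.X ≅ X) :
    IsEquivalence A (transport A w) w := by
  refine ⟨?_, rfl⟩
  change μ[A.X] ≫ w.hom = (w.hom ⊗ₘ w.hom) ≫ (w.inv ⊗ₘ w.inv) ≫ μ[A.X] ≫ w.hom
  simp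

theorem IsAction.transport {A : Mon C} {V X : C} {n : A.X ⊗ V ⟶ V} (hn : IsAction A n)
    (w : A.X ≅ X) : IsAction (transport A w) (w.inv ▷ V ≫ n) := by
  change ((w.inv ⊗ₘ w.inv) ≫ μ[A.X] ≫ w.hom) ▷ V ≫ w.inv ▷ V ≫ n =
    (α_ X X V).hom ≫ X ◁ (w.inv ▷ V ≫ n) ≫ w.inv ▷ V ≫ n
  calc _ = ((w.inv ⊗ₘ w.inv) ≫ μ[A.X]) ▷ V ≫ n := by
        rw [← comp_whiskerRight_assoc]; simp
    _ = (w.inv ⊗ₘ w.inv) ▷ V ≫ (α_ _ _ _).hom ≫ A.X ◁ n ≫ n := by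
        rw [comp_whiskerRight_assoc, hn]
    _ = _ := by
        rw [tensorHom_def', comp_whiskerRight_assoc, associator_naturality_left_assoc,
          associator_naturality_middle_assoc]
        simp only [MonoidalCategory.whiskerLeft_comp, Category.assoc, ← whisker_exchange_assoc]

variable {V Y : C} [ExactPairing V Y]

theorem tensorRightHomEquiv_symm_comp_whiskerRight {W Z Z' : C} (f : W ⟶ Z ⊗ Y) (g : Z ⟶ Z') :
    (tensorRightHomEquiv W V Y Z').symm (f ≫ g ▷ Y) =
      (tensorRightHomEquiv W V Y Z).symm f ≫ g := by
  rw [Equiv.symm_apply_eq, tensorRightHomEquiv_naturality, Equiv.apply_symm_apply]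

theorem tensorRightHomEquiv_symm_whiskerLeft {W Z : C} (X : C) (f : W ⟶ Z ⊗ Y) :
    (tensorRightHomEquiv (X ⊗ W) V Y (X ⊗ Z)).symm (X ◁ f ≫ (α_ X Z Y).inv) =
      (α_ X W V).hom ≫ X ◁ (tensorRightHomEquiv W V Y Z).symm f := by
  simp only [tensorRightHomEquiv, Equiv.coe_fn_symm_mk]
  monoidal

theorem tensorRightHomEquiv_symm_freeAction {W X Z : C} (n : X ⊗ Z ⟶ Z) (f : W ⟶ Z ⊗ Y) :
    (tensorRightHomEquiv (X ⊗ W) V Y Z).symm (X ◁ f ≫ freeAction Y n) =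
      (α_ X W V).hom ≫ X ◁ (tensorRightHomEquiv W V Y Z).symm f ≫ n := by
  rw [freeAction, ← Category.assoc, tensorRightHomEquiv_symm_comp_whiskerRight,
    tensorRightHomEquiv_symm_whiskerLeft, Category.assoc]

/-- The morphism `(Z ⊗ Y) ⊗ V ⟶ Z` contracting `Y` with `V` by the evaluation. -/
def contraction (V Y : C) [ExactPairing V Y] (Z : C) : (Z ⊗ Y) ⊗ V ⟶ Z :=
  (tensorRightHomEquiv (Z ⊗ Y) V Y Z).symm (𝟙 (Z ⊗ Y))

theorem tensorRightHomEquiv_symm_eq_comp_contraction {W Z : C} (f : W ⟶ Z ⊗ Y) :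
    (tensorRightHomEquiv W V Y Z).symm f = f ▷ V ≫ contraction V Y Z := by
  rw [contraction, ← tensorRightHomEquiv_symm_naturality, Category.comp_id]

theorem freeAction_whiskerRight_comp_contraction {X Z : C} (n : X ⊗ Z ⟶ Z) :
    freeAction Y n ▷ V ≫ contraction V Y Z =
      (α_ X (Z ⊗ Y) V).hom ≫ X ◁ contraction V Y Z ≫ n := by
  rw [← tensorRightHomEquiv_symm_eq_comp_contraction, contraction,
    ← tensorRightHomEquiv_symm_freeAction]
  simp

theorem IsAction.whiskerLeft_tensorRightHomEquiv_comp_freeAction {A : Mon C} {n : A.X ⊗ V ⟶ V}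
    (hn : IsAction A n) :
    A.X ◁ tensorRightHomEquiv A.X V Y V n ≫ freeAction Y n =
      μ[A.X] ≫ tensorRightHomEquiv A.X V Y V n := by
  apply (tensorRightHomEquiv _ V Y V).symm.injective
  rw [tensorRightHomEquiv_symm_freeAction, tensorRightHomEquiv_symm_naturality,
    Equiv.symm_apply_apply, hn]

end Actions

section FreeModules

variable {C : Type u} [Category.{v} C] [Preadditive C] [Linear ℂ C]
  [MonoidalCategory C] [MonoidalPreadditive C] [MonoidalLinear ℂ C] [CStarTensorCategory C]

theorem dag_freeAction {X Z : C} (Y : C) (n : X ⊗ Z ⟶ Z) :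
    dag (freeAction Y n) = dag n ▷ Y ≫ (α_ X Z Y).hom := by
  rw [freeAction, dag_comp, dag_whiskerRight, dag_associator_inv]

theorem dag_freeAction_comp_freeAction {X Z : C} (Y : C) (n : X ⊗ Z ⟶ Z) :
    dag (freeAction Y n) ≫ freeAction Y n = (dag n ≫ n) ▷ Y := by
  rw [dag_freeAction, freeAction]
  simp

/-- The map `q ↦ n (1 ⊗ q) n*` attached to `n : X ⊗ Z ⟶ Z`. -/
def actionMap {X Z : C} (n : X ⊗ Z ⟶ Z) : (Z ⟶ Z) →ₗ[ℂ] (Z ⟶ Z) where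
  toFun q := dag n ≫ X ◁ q ≫ n
  map_add' p q := by simp [MonoidalPreadditive.whiskerLeft_add]
  map_smul' c q := by simp [MonoidalLinear.whiskerLeft_smul]

theorem actionMap_apply {X Z : C} (n : X ⊗ Z ⟶ Z) (q : Z ⟶ Z) :
    actionMap n q = dag n ≫ X ◁ q ≫ n := rfl

theorem actionMap_comp_dag {X Z : C} (n : X ⊗ Z ⟶ Z) (t : Z ⟶ Z) :
    actionMap n (t ≫ dag t) = dag (X ◁ dag t ≫ n) ≫ X ◁ dag t ≫ n := by
  simp [actionMap_apply, dag_comp, dag_whiskerLeft, dag_dag]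

theorem actionMap_nonneg {X Z : C} (n : X ⊗ Z ⟶ Z) {q : Z ⟶ Z} (hq : 0 ≤ q) :
    0 ≤ actionMap n q := by
  obtain ⟨t, rfl⟩ := nonneg_iff.1 hq
  rw [actionMap_comp_dag]
  exact dag_comp_nonneg _

section PartialTrace

variable (V : C) {Y : C} [ExactPairing V Y]

/-- The partial trace over `Y`, computed from the evaluation of `Y` on `V`. -/
def partialTrace (Z : C) : (Z ⊗ Y ⟶ Z ⊗ Y) →ₗ[ℂ] (Z ⟶ Z) where
  toFun a := dag (contraction V Y Z) ≫ a ▷ V ≫ contraction V Y Z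
  map_add' a b := by simp [MonoidalPreadditive.add_whiskerRight]
  map_smul' c a := by simp [MonoidalLinear.smul_whiskerRight]

theorem partialTrace_apply {Z : C} (a : Z ⊗ Y ⟶ Z ⊗ Y) :
    partialTrace V Z a = dag (contraction V Y Z) ≫ a ▷ V ≫ contraction V Y Z := rfl

theorem partialTrace_dag_comp {W Z : C} (f : W ⟶ Z ⊗ Y) :
    partialTrace V Z (dag f ≫ f) =
      dag ((tensorRightHomEquiv W V Y Z).symm f) ≫ (tensorRightHomEquiv W V Y Z).symm f := by
  simp [partialTrace_apply, tensorRightHomEquiv_symm_eq_comp_contraction, dag_comp,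
    dag_whiskerRight]

theorem eq_zero_of_partialTrace_dag_comp {W Z : C} {f : W ⟶ Z ⊗ Y}
    (hf : partialTrace V Z (dag f ≫ f) = 0) : f = 0 := by
  rw [partialTrace_dag_comp] at hf
  apply (tensorRightHomEquiv W V Y Z).symm.injective
  rw [eq_zero_of_dag_comp hf, tensorRightHomEquiv_symm_eq_comp_contraction]
  simp

theorem partialTrace_nonneg {Z : C} {a : Z ⊗ Y ⟶ Z ⊗ Y} (ha : 0 ≤ a) :
    0 ≤ partialTrace V Z a := by
  obtain ⟨t, rfl⟩ := nonneg_iff.1 ha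
  have := partialTrace_dag_comp V (dag t)
  rw [dag_dag] at this
  exact this ▸ dag_comp_nonneg _

theorem partialTrace_actionMap_freeAction {X Z : C} (n : X ⊗ Z ⟶ Z) (a : Z ⊗ Y ⟶ Z ⊗ Y) :
    partialTrace V Z (actionMap (freeAction Y n) a) = actionMap n (partialTrace V Z a) := by
  have hdag := congrArg dag (freeAction_whiskerRight_comp_contraction (V := V) (Y := Y) n)
  simp only [dag_comp, dag_whiskerRight, dag_whiskerLeft, dag_associator_hom,
    Category.assoc] at hdag
  simp only [partialTrace_apply, actionMap_apply, comp_whiskerRight, Category.assoc,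
    freeAction_whiskerRight_comp_contraction, reassoc_of% hdag]
  simp

end PartialTrace

section Submodules

theorem dag_comp_self_of_whiskerLeft_comp_comp_eq {X Z : C} {N : X ⊗ Z ⟶ Z} {l : ℂ}
    (hN : dag N ≫ N = l • 𝟙 Z) {P : Z ⟶ Z} (hP : dag P = P) (hPP : P ≫ P = P)
    (hsub : X ◁ P ≫ N ≫ P = X ◁ P ≫ N) :
    dag (N ≫ P - X ◁ P ≫ N) ≫ (N ≫ P - X ◁ P ≫ N) = l • P - actionMap N P := by
  have hsub_dag : P ≫ dag N ≫ X ◁ P = dag N ≫ X ◁ P := by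
    simpa only [dag_comp, dag_whiskerLeft, hP, Category.assoc] using congrArg dag hsub
  have hNN : P ≫ dag N ≫ N ≫ P = l • P := by
    rw [reassoc_of% hN, Linear.smul_comp, Linear.comp_smul, Category.id_comp, hPP]
  have hcross : P ≫ dag N ≫ X ◁ P ≫ N = dag N ≫ X ◁ P ≫ N := by rw [reassoc_of% hsub_dag]
  have hproj : X ◁ P ≫ X ◁ P ≫ N = X ◁ P ≫ N := by
    rw [← MonoidalCategory.whiskerLeft_comp_assoc, hPP]
  simp only [dag_sub, dag_comp, dag_whiskerLeft, hP, Preadditive.sub_comp, Preadditive.comp_sub,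
    Category.assoc, hNN, hcross, hsub, hproj, actionMap_apply]
  abel

/-- The defect of the complement of `P` from being a submodule is a morphism `f` with
`f f* = l P - N (1 ⊗ P) N*`, whose partial trace vanishes by recurrence. -/
theorem IsRecurrent.freeAction_comp_eq_whiskerLeft_comp (V : C) {X Y Z : C} [ExactPairing V Y]
    {n : X ⊗ Z ⟶ Z} {l : ℂ} (hrec : IsRecurrent (actionMap n) l) (hn : dag n ≫ n = l • 𝟙 Z)
    {P : Z ⊗ Y ⟶ Z ⊗ Y} (hP : dag P = P) (hPP : P ≫ P = P)
    (hsub : X ◁ P ≫ freeAction Y n ≫ P = X ◁ P ≫ freeAction Y n) :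
    freeAction Y n ≫ P = X ◁ P ≫ freeAction Y n := by
  have hN : dag (freeAction Y n) ≫ freeAction Y n = l • 𝟙 (Z ⊗ Y) := by
    rw [dag_freeAction_comp_freeAction, hn, MonoidalLinear.smul_whiskerRight, id_whiskerRight]
  have hdefect := dag_comp_self_of_whiskerLeft_comp_comp_eq hN hP hPP hsub
  have htrace := congrArg (partialTrace V Z) hdefect
  rw [map_sub, map_smul, partialTrace_actionMap_freeAction] at htrace
  have hsuper : IsSuperharmonic (actionMap n) l (partialTrace V Z P) := by
    refine ⟨partialTrace_nonneg V ?_, sub_nonneg.1 ?_⟩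
    · simpa only [hP, hPP] using dag_comp_nonneg P
    · exact htrace ▸ partialTrace_nonneg V (dag_comp_nonneg _)
  rw [hrec _ hsuper, sub_self] at htrace
  exact sub_eq_zero.1 (eq_zero_of_partialTrace_dag_comp V htrace)

end Submodules

section Frobenius

variable {A : Mon C} {V Y : C} [ExactPairing V Y] {n : A.X ⊗ V ⟶ V}

theorem isCStarFrobenius_of_mul_comp_dag_mul (hA : μ[A.X] ≫ dag μ[A.X] =
    dag μ[A.X] ▷ A.X ≫ (α_ A.X A.X A.X).hom ≫ A.X ◁ μ[A.X]) : IsCStarFrobenius A := by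
  refine ⟨Eq.symm ?_, hA⟩
  simpa only [dag_comp, dag_dag, dag_whiskerLeft, dag_whiskerRight, dag_associator_hom,
    Category.assoc] using congrArg dag hA

theorem comp_dag_eq_of_tensorRightHomEquiv_comp_dag_freeAction {X : C} {n : X ⊗ V ⟶ V}
    {c : X ⟶ X ⊗ X} (h : tensorRightHomEquiv X V Y V n ≫ dag (freeAction Y n) =
      c ≫ X ◁ tensorRightHomEquiv X V Y V n) :
    n ≫ dag n = c ▷ V ≫ (α_ X X V).hom ≫ X ◁ n := by
  have hbend : tensorRightHomEquiv X V Y V n ≫ dag n ▷ Y =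
      c ≫ X ◁ tensorRightHomEquiv X V Y V n ≫ (α_ X V Y).inv := by
    rw [← reassoc_of% h, dag_freeAction]
    simp
  have hunbend := congrArg (tensorRightHomEquiv X V Y (X ⊗ V)).symm hbend
  rwa [tensorRightHomEquiv_symm_comp_whiskerRight, tensorRightHomEquiv_symm_naturality,
    tensorRightHomEquiv_symm_whiskerLeft, Equiv.symm_apply_apply] at hunbend

theorem freeAction_comp_dag_freeAction {X Z : C} {n : X ⊗ Z ⟶ Z} {c : X ⟶ X ⊗ X}
    (h : n ≫ dag n = c ▷ Z ≫ (α_ X X Z).hom ≫ X ◁ n) (Y : C) :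
    freeAction Y n ≫ dag (freeAction Y n) =
      c ▷ (Z ⊗ Y) ≫ (α_ X X (Z ⊗ Y)).hom ≫ X ◁ freeAction Y n := by
  rw [dag_freeAction, freeAction, Category.assoc, ← comp_whiskerRight_assoc, h]
  simp

/-- If `A` sits isometrically inside a free action as a submodule with invariant complement, the
Frobenius relation is inherited from the unitarity of the associator. -/
theorem IsAction.isCStarFrobenius (hn : IsAction A n) {π : A.X ⟶ V ⊗ Y}
    (hπ : π = tensorRightHomEquiv A.X V Y V n) (hiso : π ≫ dag π = 𝟙 A.X)
    (hsub : freeAction Y n ≫ dag π ≫ π = A.X ◁ (dag π ≫ π) ≫ freeAction Y n) :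
    IsCStarFrobenius A := by
  have hmod : A.X ◁ π ≫ freeAction Y n = μ[A.X] ≫ π :=
    hπ ▸ hn.whiskerLeft_tensorRightHomEquiv_comp_freeAction
  have hproj : freeAction Y n ≫ dag π = A.X ◁ dag π ≫ μ[A.X] := by
    calc freeAction Y n ≫ dag π = (freeAction Y n ≫ dag π ≫ π) ≫ dag π := by simp [hiso]
      _ = A.X ◁ dag π ≫ μ[A.X] := by
          rw [hsub, MonoidalCategory.whiskerLeft_comp, Category.assoc, Category.assoc,
            reassoc_of% hmod, hiso, Category.comp_id]
  have hcomod : π ≫ dag (freeAction Y n) = dag μ[A.X] ≫ A.X ◁ π := by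
    simpa only [dag_comp, dag_whiskerLeft, dag_dag] using congrArg dag hproj
  have hfree := freeAction_comp_dag_freeAction
    (comp_dag_eq_of_tensorRightHomEquiv_comp_dag_freeAction (hπ ▸ hcomod)) Y
  apply isCStarFrobenius_of_mul_comp_dag_mul
  calc μ[A.X] ≫ dag μ[A.X] = (μ[A.X] ≫ π) ≫ dag (μ[A.X] ≫ π) := by
        rw [dag_comp, Category.assoc, reassoc_of% hiso]
    _ = A.X ◁ π ≫ (freeAction Y n ≫ dag (freeAction Y n)) ≫ A.X ◁ dag π := by
        simp only [← hmod, dag_comp, dag_whiskerLeft, Category.assoc]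
    _ = dag μ[A.X] ▷ A.X ≫ (α_ _ _ _).hom ≫ A.X ◁ (A.X ◁ π ≫ freeAction Y n ≫ dag π) := by
        rw [hfree, Category.assoc, whisker_exchange_assoc]
        simp
    _ = dag μ[A.X] ▷ A.X ≫ (α_ _ _ _).hom ≫ A.X ◁ μ[A.X] := by
        rw [reassoc_of% hmod, hiso, Category.comp_id]

/-- With `π` the representation of `A` on `V ⊗ Y`, transporting along the square root of `π* π`
makes it isometric. -/
theorem IsAction.isCStarFrobenius_transport (hn : IsAction A n) {l : ℂ}
    (hcoiso : dag n ≫ n = l • 𝟙 V) (hrec : IsRecurrent (actionMap n) l) {w : A.X ≅ A.X}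
    (hw : dag w.hom = w.hom) (hww : w.hom ≫ w.hom = tensorRightHomEquiv A.X V Y V n ≫
      dag (tensorRightHomEquiv A.X V Y V n)) :
    IsCStarFrobenius (CStarTensorCategory.transport A w) := by
  have hmod := hn.whiskerLeft_tensorRightHomEquiv_comp_freeAction (Y := Y)
  set π := tensorRightHomEquiv A.X V Y V n with hπ
  have hw' : dag w.inv = w.inv := by
    rw [← cancel_epi w.hom, w.hom_inv_id, ← dag_id, ← w.inv_hom_id, dag_comp, hw]
  have hiso : (w.inv ≫ π) ≫ dag (w.inv ≫ π) = 𝟙 A.X := by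
    rw [dag_comp, hw', Category.assoc, ← Category.assoc π, ← hww]
    simp
  obtain ⟨P, hP⟩ : ∃ P, P = dag (w.inv ≫ π) ≫ w.inv ≫ π := ⟨_, rfl⟩
  have hP_dag : dag P = P := by rw [hP, dag_comp, dag_dag]
  have hπP : π ≫ P = π := by
    rw [← cancel_epi w.inv, hP, ← Category.assoc, ← Category.assoc, hiso, Category.id_comp]
  have hPP : P ≫ P = P := by
    nth_rw 1 [hP]
    rw [Category.assoc, Category.assoc, hπP, hP]
  have hsub : A.X ◁ P ≫ freeAction Y n ≫ P = A.X ◁ P ≫ freeAction Y n := by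
    have hPN : A.X ◁ P ≫ freeAction Y n =
        A.X ◁ (dag (w.inv ≫ π) ≫ w.inv) ≫ μ[A.X] ≫ π := by
      rw [hP, ← hmod]; simp
    rw [← Category.assoc, hPN]
    simp only [Category.assoc, hπP]
  have hcompl := hrec.freeAction_comp_eq_whiskerLeft_comp V hcoiso hP_dag hPP hsub
  have hrep : w.inv ≫ π = tensorRightHomEquiv A.X V Y V (w.inv ▷ V ≫ n) := by
    rw [hπ, ← Equiv.symm_apply_eq, tensorRightHomEquiv_symm_naturality, Equiv.symm_apply_apply]
  refine (hn.transport w).isCStarFrobenius hrep hiso ?_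
  rw [← hP, freeAction_whiskerRight_comp, Category.assoc, hcompl]
  exact (whisker_exchange_assoc _ _ _).symm

end Frobenius

end FreeModules

/-! ### Rigid haploid algebras -/

section Transport

variable {C : Type u} [Category.{v} C] [MonoidalCategory C] {A B : Mon C}

/-- The action `n`, carried over to `W` by `t : W ≅ Z`. -/
def conjAction {X Z W : C} (n : X ⊗ Z ⟶ Z) (t : W ≅ Z) : X ⊗ W ⟶ W :=
  X ◁ t.hom ≫ n ≫ t.inv

theorem IsAction.conjAction {Z W : C} {n : A.X ⊗ Z ⟶ Z} (hn : IsAction A n)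
    (t : W ≅ Z) : IsAction A (conjAction n t) := by
  calc μ[A.X] ▷ W ≫ A.X ◁ t.hom ≫ n ≫ t.inv
      = (A.X ⊗ A.X) ◁ t.hom ≫ (μ[A.X] ▷ Z ≫ n) ≫ t.inv := by
        rw [← whisker_exchange_assoc, Category.assoc]
    _ = (α_ _ _ _).hom ≫ A.X ◁ (A.X ◁ t.hom ≫ n ≫ t.inv) ≫ A.X ◁ t.hom ≫ n ≫ t.inv := by
        rw [show _ = _ from hn]; simp

theorem eq_zero_of_whiskerRight_comp_conjAction_mul [Preadditive C] {X W : C} {t : W ≅ A.X}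
    {x : X ⟶ A.X} (hx : x ▷ W ≫ conjAction μ[A.X] t = 0) : x = 0 := by
  have hcyclic : (ρ_ A.X).inv ≫ A.X ◁ (η[A.X] ≫ t.inv) ≫ conjAction μ[A.X] t = t.inv := by
    simp [conjAction, ← MonoidalCategory.whiskerLeft_comp_assoc]
  calc x = x ≫ ((ρ_ A.X).inv ≫ A.X ◁ (η[A.X] ≫ t.inv) ≫ conjAction μ[A.X] t) ≫ t.hom := by
        rw [hcyclic, t.inv_hom_id, Category.comp_id]
    _ = (ρ_ X).inv ≫ X ◁ (η[A.X] ≫ t.inv) ≫ (x ▷ W ≫ conjAction μ[A.X] t) ≫ t.hom := by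
        simp [whisker_exchange_assoc]
    _ = 0 := by rw [hx]; simp

variable [Preadditive C] [Linear ℂ C]

theorem IsHaploid.of_iso (hA : IsHaploid A) (w : A.X ≅ B.X) : IsHaploid B :=
  (Linear.homCongr ℂ (Iso.refl _) w).symm.finrank_eq.trans hA

/-- Multiplication by a nonzero scalar, used to normalize the unit of an algebra. -/
@[simps] noncomputable def scalarIso (c : ℂˣ) (X : C) : X ≅ X where
  hom := (c : ℂ) • 𝟙 X
  inv := (c⁻¹ : ℂ) • 𝟙 X

theorem unit_transport_scalarIso (c : ℂˣ) :
    η[(transport A (scalarIso c A.X)).X] = (c : ℂ) • η[A.X] := by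
  change η[A.X] ≫ ((c : ℂ) • 𝟙 A.X) = _
  simp

theorem mul_transport_scalarIso [MonoidalPreadditive C] [MonoidalLinear ℂ C] (c : ℂˣ) :
    μ[(transport A (scalarIso c A.X)).X] = (c⁻¹ : ℂ) • μ[A.X] := by
  change (((c⁻¹ : ℂ) • 𝟙 A.X) ⊗ₘ ((c⁻¹ : ℂ) • 𝟙 A.X)) ≫ μ[A.X] ≫ ((c : ℂ) • 𝟙 A.X) = _
  simp [MonoidalCategory.tensorHom_def, MonoidalLinear.whiskerLeft_smul,
    MonoidalLinear.smul_whiskerRight]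

end Transport

section RigidHaploidAlgebras

variable {C : Type u} [Category.{v} C] [Preadditive C] [Linear ℂ C]
  [MonoidalCategory C] [MonoidalPreadditive C] [MonoidalLinear ℂ C] [CStarTensorCategory C]

section Irreducibility

/-- The kernel of a superharmonic element is invariant under the action. -/
theorem IsSuperharmonic.whiskerLeft_comp_comp_eq_zero {X Z W : C} {n : X ⊗ Z ⟶ Z} {l : ℂ}
    {q : Z ⟶ Z} (hq : IsSuperharmonic (actionMap n) l q) {x : Z ⟶ W} (hx : q ≫ x = 0) :
    X ◁ q ≫ n ≫ x = 0 := by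
  obtain ⟨t, rfl⟩ := nonneg_iff.1 hq.1
  have hsq : dag x ≫ actionMap n (t ≫ dag t) ≫ x =
      dag (X ◁ dag t ≫ n ≫ x) ≫ X ◁ dag t ≫ n ≫ x := by
    simp [actionMap_comp_dag, dag_comp]
  have hnonpos : 0 ≤ -(dag x ≫ actionMap n (t ≫ dag t) ≫ x) := by
    have := dag_comp_comp_nonneg (sub_nonneg.2 hq.2) x
    rw [Preadditive.sub_comp, Linear.smul_comp, hx] at this
    simpa using this
  have hzero : X ◁ dag t ≫ n ≫ x = 0 := eq_zero_of_dag_comp <|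
    le_antisymm (hsq ▸ neg_nonneg.1 hnonpos) (dag_comp_nonneg _)
  rw [MonoidalCategory.whiskerLeft_comp, Category.assoc, hzero, Limits.comp_zero]

variable {A : Mon C} {l : ℂ} {q : A.X ⟶ A.X}

theorem IsHaploid.comp_superharmonic_eq_zero (hA : IsHaploid A)
    (hq : IsSuperharmonic (actionMap μ[A.X]) l q) {Z : C} {x : A.X ⟶ Z} (hx : q ≫ x = 0)
    (hx0 : x ≠ 0) (f : 𝟙_ C ⟶ A.X) : f ≫ q = 0 := by
  obtain ⟨c, hc⟩ := hA.exists_eq_smul_unit (f ≫ q)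
  have hcx : c • x = 0 := by
    calc c • x = (ρ_ A.X).inv ≫ A.X ◁ (c • η[A.X]) ≫ μ[A.X] ≫ x := by
          simp [MonoidalLinear.whiskerLeft_smul]
      _ = (ρ_ A.X).inv ≫ A.X ◁ f ≫ A.X ◁ q ≫ μ[A.X] ≫ x := by
          rw [← hc, MonoidalCategory.whiskerLeft_comp, Category.assoc]
      _ = 0 := by
          rw [hq.whiskerLeft_comp_comp_eq_zero hx, Limits.comp_zero, Limits.comp_zero]
  rw [hc, (smul_eq_zero.1 hcx).resolve_right hx0, zero_smul]

theorem IsSuperharmonic.eq_zero_of_comp_eq_zero {e : A.X ⟶ 𝟙_ C} (p : ExactPairing A.X A.X)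
    (hp : p.evaluation' = μ[A.X] ≫ e) (hq : IsSuperharmonic (actionMap μ[A.X]) l q)
    (hqe : q ≫ e = 0) : q = 0 := by
  have hev : A.X ◁ q ≫ p.evaluation' = 0 := hp ▸ hq.whiskerLeft_comp_comp_eq_zero hqe
  have hsnake : 𝟙_ C ◁ q ≫ (λ_ A.X).hom ≫ (ρ_ A.X).inv = 0 := by
    rw [← p.evaluation_coevaluation', whisker_exchange_assoc,
      associator_naturality_right_assoc, ← MonoidalCategory.whiskerLeft_comp, hev]
    simp
  calc q = (λ_ A.X).inv ≫ (𝟙_ C ◁ q ≫ (λ_ A.X).hom ≫ (ρ_ A.X).inv) ≫ (ρ_ A.X).hom := by simp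
    _ = 0 := by rw [hsnake]; simp

theorem IsHaploid.isIso_of_isSuperharmonic (hA : IsHaploid A) [Module.Finite ℂ (A.X ⟶ A.X)]
    {e : A.X ⟶ 𝟙_ C} (p : ExactPairing A.X A.X) (hp : p.evaluation' = μ[A.X] ≫ e)
    (hq : IsSuperharmonic (actionMap μ[A.X]) l q) (hq0 : q ≠ 0) : IsIso q := by
  refine isIso_of_forall_comp_eq_zero fun x hx ↦ by_contra fun hx0 ↦ hq0 ?_
  refine hq.eq_zero_of_comp_eq_zero p hp ?_
  rw [← dag_dag (q ≫ e), dag_comp, dag_eq_of_nonneg hq.1,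
    hA.comp_superharmonic_eq_zero hq hx hx0, dag_zero]

end Irreducibility

section Conjugation

variable {X Z W : C} {n : X ⊗ Z ⟶ Z} {l : ℂ} {t : W ≅ Z}

theorem actionMap_conjAction (q : W ⟶ W) :
    actionMap (conjAction n t) q =
      dag t.inv ≫ actionMap n (dag t.hom ≫ q ≫ t.hom) ≫ t.inv := by
  simp [actionMap_apply, conjAction, dag_comp, dag_whiskerLeft]

theorem dag_inv_comp_dag_hom (t : W ≅ Z) : dag t.inv ≫ dag t.hom = 𝟙 W := by
  rw [← dag_comp, t.hom_inv_id, dag_id]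

theorem dag_hom_comp_dag_inv (t : W ≅ Z) : dag t.hom ≫ dag t.inv = 𝟙 Z :=
  dag_inv_comp_dag_hom t.symm

theorem dag_conjAction_comp_conjAction
    (ht : actionMap n (dag t.hom ≫ t.hom) = l • (dag t.hom ≫ t.hom)) :
    dag (conjAction n t) ≫ conjAction n t = l • 𝟙 W := by
  calc _ = actionMap (conjAction n t) (𝟙 W) := by simp [actionMap_apply]
    _ = dag t.inv ≫ (l • (dag t.hom ≫ t.hom)) ≫ t.inv := by
        rw [actionMap_conjAction, Category.id_comp, ht]
    _ = l • 𝟙 W := by simp [dag_inv_comp_dag_hom]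

theorem IsRecurrent.conjAction (hrec : IsRecurrent (actionMap n) l) :
    IsRecurrent (actionMap (conjAction n t)) l := by
  intro p hp
  have hdiff : l • (dag t.hom ≫ p ≫ t.hom) - actionMap n (dag t.hom ≫ p ≫ t.hom) =
      dag t.hom ≫ (l • p - actionMap (CStarTensorCategory.conjAction n t) p) ≫ t.hom := by
    simp [actionMap_conjAction, reassoc_of% dag_hom_comp_dag_inv t]
  have hsuper : IsSuperharmonic (actionMap n) l (dag t.hom ≫ p ≫ t.hom) :=
    ⟨dag_comp_comp_nonneg hp.1 _,
      sub_nonneg.1 (hdiff ▸ dag_comp_comp_nonneg (sub_nonneg.2 hp.2) _)⟩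
  rw [actionMap_conjAction, hrec _ hsuper]
  simp [reassoc_of% dag_inv_comp_dag_hom t]

end Conjugation

section Existence

variable {A : Mon C}

theorem isIso_tensorRightHomEquiv_comp_dag {X V Y : C} [ExactPairing V Y]
    [Module.Finite ℂ (X ⟶ X)] {n : X ⊗ V ⟶ V} (hn : ∀ x : X ⟶ X, x ▷ V ≫ n = 0 → x = 0) :
    IsIso (tensorRightHomEquiv X V Y V n ≫ dag (tensorRightHomEquiv X V Y V n)) := by
  refine isIso_of_forall_comp_eq_zero fun x hx ↦ ?_
  set π := tensorRightHomEquiv X V Y V n with hπ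
  have hxπ : dag x ≫ π = 0 := eq_zero_of_comp_dag <| by
    rw [dag_comp, dag_dag, Category.assoc, ← Category.assoc π, hx, Limits.comp_zero]
  have hxn : dag x ▷ V ≫ n = 0 := by
    rw [← (tensorRightHomEquiv X V Y V).symm_apply_apply n, ← tensorRightHomEquiv_symm_naturality,
      ← hπ, hxπ]
    simp [tensorRightHomEquiv_symm_eq_comp_contraction]
  rw [← dag_dag x, hn _ hxn, dag_zero]

theorem IsHaploid.exists_isCStarFrobenius_transport (hC : SimpleUnit C) (hA : IsHaploid A)
    (hr : IsRigid A) : ∃ w : A.X ≅ A.X, IsCStarFrobenius (transport A w) := by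
  obtain ⟨e, -, p, hp⟩ := hr
  have : Module.Finite ℂ (A.X ⟶ A.X) := finite_end_of_exactPairing hC A.X A.X
  obtain ⟨t, l, ht, heig, hrec⟩ := exists_iso_eigenvector_isRecurrent hA.id_ne_zero
    (fun _ ↦ actionMap_nonneg μ[A.X]) (fun _ _ hq hq0 ↦ hA.isIso_of_isSuperharmonic p hp hq hq0)
  have hmul : IsAction A μ[A.X] := MonObj.mul_assoc A.X
  have := isIso_tensorRightHomEquiv_comp_dag (Y := A.X) (n := conjAction μ[A.X] t)
    fun _ ↦ eq_zero_of_whiskerRight_comp_conjAction_mul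
  obtain ⟨w, hw, hww⟩ := exists_iso_sqrt_of_nonneg
    (comp_dag_nonneg (tensorRightHomEquiv A.X A.X A.X A.X (conjAction μ[A.X] t)))
  exact ⟨w, (hmul.conjAction t).isCStarFrobenius_transport
    (dag_conjAction_comp_conjAction (by rw [ht, heig])) hrec.conjAction hw hww⟩

theorem IsCStarFrobenius.transport_scalarIso (hA : IsCStarFrobenius A) (c : ℂˣ) :
    IsCStarFrobenius (transport A (scalarIso c A.X)) := by
  apply isCStarFrobenius_of_mul_comp_dag_mul
  rw [mul_transport_scalarIso]
  simp [dag_smul, MonoidalLinear.whiskerLeft_smul, MonoidalLinear.smul_whiskerRight, hA.2,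
    smul_smul, mul_comm]

open scoped ComplexOrder in
theorem IsHaploid.exists_isNormalized_transport_scalarIso (hC : SimpleUnit C)
    (hA : IsHaploid A) : ∃ c : ℂˣ, IsNormalized (transport A (scalarIso c A.X)) := by
  obtain ⟨r, hr, hη⟩ : ∃ r : ℝ, 0 ≤ r ∧ η[A.X] ≫ dag η[A.X] = (r : ℂ) • 𝟙 (𝟙_ C) := by
    obtain ⟨r, hr, hre⟩ := RCLike.nonneg_iff_exists_ofReal.1
      (unitScalar_nonneg hC (comp_dag_nonneg η[A.X]))
    exact ⟨r, hr, by rw [← unitScalar_smul_id hC (η[A.X] ≫ dag η[A.X]), ← hre]; rfl⟩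
  have hr0 : r ≠ 0 := by
    rintro rfl
    exact hA.unit_ne_zero (eq_zero_of_comp_dag (by simpa using hη))
  have hscale : (√r)⁻¹ * (√r)⁻¹ * r = 1 := by
    rw [← mul_inv, Real.mul_self_sqrt hr, inv_mul_cancel₀ hr0]
  refine ⟨Units.mk0 ((√r)⁻¹ : ℝ) (by simpa [Real.sqrt_eq_zero hr] using hr0), ?_⟩
  rw [IsNormalized, unit_transport_scalarIso, dag_smul, Linear.smul_comp, Linear.comp_smul, hη,
    smul_smul, smul_smul, Units.val_mk0, Complex.conj_ofReal]
  exact_mod_cast (congrArg (fun c : ℝ ↦ (c : ℂ) • 𝟙 (𝟙_ C)) hscale).trans (by simp)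

theorem IsNormalized.mono_unit (hA : IsNormalized A) : Mono η[A.X] :=
  (SplitMono.mk (dag η[A.X]) hA).mono

theorem IsHaploid.exists_equivalent_isQSystem (hC : SimpleUnit C) (hA : IsHaploid A)
    (hr : IsRigid A) :
    ∃ B : Mon C, IsQSystem B ∧ IsHaploid B ∧ IsNormalized B ∧ Equivalent B A := by
  obtain ⟨w, hF⟩ := hA.exists_isCStarFrobenius_transport hC hr
  have hA' : IsHaploid (transport A w) := hA.of_iso w
  obtain ⟨c, hn⟩ := hA'.exists_isNormalized_transport_scalarIso hC
  set w' := scalarIso c (transport A w).X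
  have hF' : IsCStarFrobenius (transport (transport A w) w') := hF.transport_scalarIso c
  have hB : IsHaploid (transport (transport A w) w') := hA'.of_iso w'
  exact ⟨transport (transport A w) w', ⟨hn.mono_unit, hF'.isSpecial hB, hF'⟩, hB, hn, _,
    ((isEquivalence_transport A w).trans (isEquivalence_transport (transport A w) w')).symm⟩

end Existence

end RigidHaploidAlgebras

/-! ### The correspondence -/

section Correspondence

variable {C : Type u} [Category.{v} C] [Preadditive C] [Linear ℂ C]
  [MonoidalCategory C] [MonoidalPreadditive C] [MonoidalLinear ℂ C] [CStarTensorCategory C]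

namespace NormalizedHaploidQSystem

theorem isStandard (A : NormalizedHaploidQSystem C) : IsStandard A.alg :=
  A.isQSystem.frobenius.isStandard A.haploid

theorem isUnitary (A B : NormalizedHaploidQSystem C) {S : A.alg.X ≅ B.alg.X}
    (hS : IsEquivalence A.alg B.alg S) : IsUnitary S.hom :=
  IsEquivalence.isUnitary A.isQSystem.frobenius A.normalized B.isQSystem.frobenius B.haploid
    B.normalized hS

/-- The rigid haploid algebra underlying a normalized haploid Q-system. -/
def toRigidHaploidAlgebra (A : NormalizedHaploidQSystem C) : RigidHaploidAlgebra C :=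
  ⟨A.alg, A.isQSystem.mono_unit, A.haploid, A.isQSystem.frobenius.isRigid A.normalized⟩

end NormalizedHaploidQSystem

/-- The underlying-algebra map from unitary equivalence classes of normalized haploid Q-systems
to equivalence classes of rigid haploid algebras. -/
def NormalizedHaploidQSystemClass.toRigidHaploidAlgebraClass :
    NormalizedHaploidQSystemClass C → RigidHaploidAlgebraClass C :=
  Quotient.map NormalizedHaploidQSystem.toRigidHaploidAlgebra fun _ _ ⟨S, hS, _⟩ ↦ ⟨S, hS⟩

namespace NormalizedHaploidQSystemClass

theorem toRigidHaploidAlgebraClass_injective :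
    Function.Injective (toRigidHaploidAlgebraClass (C := C)) := by
  rintro ⟨A⟩ ⟨B⟩ hAB
  obtain ⟨S, hS⟩ := Quotient.exact hAB
  exact Quotient.sound ⟨S, hS, A.isUnitary B hS⟩

theorem toRigidHaploidAlgebraClass_surjective (hC : SimpleUnit C) :
    Function.Surjective (toRigidHaploidAlgebraClass (C := C)) := by
  rintro ⟨A⟩
  obtain ⟨B, hQ, hhaploid, hnormalized, hBA⟩ := A.haploid.exists_equivalent_isQSystem hC A.rigid
  exact ⟨Quotient.mk _ ⟨B, hQ, hhaploid, hnormalized⟩, Quotient.sound hBA⟩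

end NormalizedHaploidQSystemClass

end Correspondence

end CStarTensorCategory

theorem mainTheorem2 {C : Type u} [Category.{v} C] [Preadditive C] [Linear ℂ C]
    [MonoidalCategory C] [MonoidalPreadditive C] [MonoidalLinear ℂ C] [CStarTensorCategory C]
    (hC : CStarTensorCategory.SimpleUnit C) :
    -- normalized haploid Q-systems are standard
    (∀ A : CStarTensorCategory.NormalizedHaploidQSystem C,
      CStarTensorCategory.IsStandard A.alg) ∧
    -- every equivalence between normalized haploid Q-systems is unitary
    (∀ (A B : CStarTensorCategory.NormalizedHaploidQSystem C) (S : A.alg.X ≅ B.alg.X),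
      CStarTensorCategory.IsEquivalence A.alg B.alg S → CStarTensorCategory.IsUnitary S.hom) ∧
    -- sending a normalized haploid Q-system to its underlying algebra (which is rigid) induces
    -- a bijection on classes
    (∃ Φ : CStarTensorCategory.NormalizedHaploidQSystemClass C →
        CStarTensorCategory.RigidHaploidAlgebraClass C,
      Function.Bijective Φ ∧
      ∀ A : CStarTensorCategory.NormalizedHaploidQSystem C,
        ∃ h : CStarTensorCategory.IsRigid A.alg,
          Φ (Quotient.mk _ A) =
            Quotient.mk _ ⟨A.alg, A.isQSystem.mono_unit, A.haploid, h⟩) :=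
  ⟨fun A ↦ A.isStandard,
    fun A B _ hS ↦ A.isUnitary B hS,
    CStarTensorCategory.NormalizedHaploidQSystemClass.toRigidHaploidAlgebraClass,
    ⟨CStarTensorCategory.NormalizedHaploidQSystemClass.toRigidHaploidAlgebraClass_injective,
      CStarTensorCategory.NormalizedHaploidQSystemClass.toRigidHaploidAlgebraClass_surjective hC⟩,
    fun A ↦ ⟨A.toRigidHaploidAlgebra.rigid, rfl⟩⟩
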